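/- Let $T$ be a first-order theory in a language $L$. For a model $M$, an automorphism $\sigma$ of $M$, and a set $U\subseteq M^{r}$, put $\xi_{\sigma,U}(a)=\{n\in\mathbb Z:\sigma^n(a)\in U\}$ for $a\in M^{r}$ (with $\sigma$ acting coordinatewise), viewed as an element of $\mathcal B=2^{\mathbb Z}$; the symbolic image is $\xi_{\sigma,U}(M)=\{\xi_{\sigma,U}(a):a\in M^{r}\}\subseteq\mathcal B$. A subset of $\mathcal B$ is SW-closed if it is closed under all powers (positive and negative) of the shift and under the map $w:\mathcal B\to\mathcal B$ exchanging the values at the coordinates $0$ and $1$. For a tuple $b$ of $M$ let $W_b$ be the set of automorphisms $\sigma$ of $M$ such that $(\sigma^n(b))_{n\in\mathbb Z}$ is an indiscernible sequence (over $\emptyset$). A formula $\phi(x,y)$ ($x,y$ finite tuples of variables) has the strict order property if in some model $M$ of $T$ there is a sequence $(b_i)_{i<\omega}$ of tuples with $\phi(M,b_i)\subsetneq\phi(M,b_{i+1})$ for all $i<\omega$; $T$ is NSOP if no formula has the strict order property. Say that a model $M$ of $T$ satisfies $(\ast)$ if for every formula $\phi(x,y)$, every tuple $b$ of $M$, with $U=\phi(M,b)$,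 and every $\sigma\in W_b$, the symbolic image $\xi_{\sigma,U}(M)$ is SW-closed in $\mathcal B$. Then: (1) $T$ is NSOP if and only if every $\aleph_1$-saturated model of $T$ satisfies $(\ast)$. (2) If $T$ is complete (and consistent), then $T$ is NSOP if and only if some $\aleph_1$-saturated and strongly $\aleph_1$-homogeneous model of $T$ satisfies $(\ast)$. Here $M$ is strongly $\aleph_1$-homogeneous if any two sequences $(a_n)_{n<\omega}$, $(b_n)_{n<\omega}$ of elements of $M$ with the same type over $\emptyset$ are conjugate under an automorphism of $M$. -/

import Mathlib

open FirstOrder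

universe u v w

namespace SymbolicNSOP

/-! ### The Bernoulli system

A binary sequence indexed by `ℤ` is identified with the subset of `ℤ` on which it takes value `1`. -/

/-- The sequence `I + k`, obtained from `I` after `k` shifts: its value at `n` is `I (n - k)`. -/
def shift (k : ℤ) (I : Set ℤ) : Set ℤ := {n | n - k ∈ I}

/-- The sequence obtained from `I` by exchanging the values at the coordinates `0` and `1`. -/
def switch (I : Set ℤ) : Set ℤ := {n | Equiv.swap (0 : ℤ) 1 n ∈ I}

/-- A set of binary sequences is SW-closed if it is closed under the action of the shift
(all of its integer powers) and under the switch. -/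
def SWClosed (H : Set (Set ℤ)) : Prop :=
  (∀ (k : ℤ), ∀ I ∈ H, shift k I ∈ H) ∧ ∀ I ∈ H, switch I ∈ H

section Structures

variable {L : FirstOrder.Language.{u, v}} {M : Type w} [L.Structure M]

/-- The action of `σ ^ n` on tuples, coordinate by coordinate. -/
def autPow (σ : M ≃[L] M) (n : ℤ) {α : Type} (a : α → M) : α → M :=
  fun i => ((σ.toEquiv : Equiv.Perm M) ^ n) (a i)

/-- The symbolic representation of the tuple `a` with respect to `σ` and `U`:
the set of all `n : ℤ` with `σ ^ n (a) ∈ U`. -/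
def symbolicRep (σ : M ≃[L] M) {α : Type} (U : Set (α → M)) (a : α → M) : Set ℤ :=
  {n | autPow σ n a ∈ U}

/-- The symbolic image of the structure with respect to `σ` and `U`. -/
def symbolicImage (σ : M ≃[L] M) {α : Type} (U : Set (α → M)) : Set (Set ℤ) :=
  Set.range (symbolicRep σ U)

/-- The instance `φ(M, b)` of the formula `φ(x, y)`. -/
def formulaInstance {α β : Type} (φ : L.Formula (α ⊕ β)) (b : β → M) : Set (α → M) :=
  {a | φ.Realize (Sum.elim a b)}

variable (L) in
/-- A sequence of tuples indexed by a linear order is indiscernible (over the empty set) if any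
two increasing finite subsequences of the same length satisfy the same formulas. -/
def Indiscernible {ι : Type} [LinearOrder ι] {β : Type} (b : ι → β → M) : Prop :=
  ∀ (k : ℕ) (i j : Fin k → ι), StrictMono i → StrictMono j →
    ∀ φ : L.Formula (Fin k × β),
      φ.Realize (fun p => b (i p.1) p.2) ↔ φ.Realize (fun p => b (j p.1) p.2)

/-- The set `W_b` of all automorphisms `σ` such that `(σ ^ n (b) : n ∈ ℤ)` is indiscernible. -/
def indiscernibleAuts {β : Type} (b : β → M) : Set (M ≃[L] M) :=
  {σ | Indiscernible L fun n : ℤ => autPow σ n b}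

variable (L M)

open FirstOrder.Language in
/-- `ℵ₁`-saturation: every set of formulas in one variable with parameters in a countable set `A`
which is finitely satisfiable in `M` is realized in `M`. -/
def Aleph1Saturated : Prop :=
  ∀ A : Set M, A.Countable → ∀ p : Set (L[[A]].Formula (Fin 1)),
    (∀ q : Set (L[[A]].Formula (Fin 1)), q ⊆ p → q.Finite →
      ∃ a : Fin 1 → M, ∀ φ ∈ q, φ.Realize a) →
    ∃ a : Fin 1 → M, ∀ φ ∈ p, φ.Realize a

/-- Strong `ℵ₁`-homogeneity: any two countable tuples with the same type over the empty set are
conjugate under an automorphism. -/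
def StronglyAleph1Homogeneous : Prop :=
  ∀ a b : ℕ → M, (∀ φ : L.Formula ℕ, φ.Realize a ↔ φ.Realize b) →
    ∃ σ : M ≃[L] M, ∀ n, σ (a n) = b n

/-- For every formula `φ(x, y)` (`x`, `y` finite tuples of variables), every tuple `b` of
parameters and every `σ ∈ W_b`, the symbolic image with respect to `σ` and `φ(M, b)` is
SW-closed. -/
def SymbolicImagesSWClosed : Prop :=
  ∀ (r s : ℕ) (φ : L.Formula (Fin r ⊕ Fin s)) (b : Fin s → M),
    ∀ σ ∈ indiscernibleAuts (L := L) b, SWClosed (symbolicImage σ (formulaInstance φ b))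

end Structures

section Theories

variable {L : FirstOrder.Language.{u, v}} (T : L.Theory)

/-- The formula `φ(x, y)` has the strict order property: in some model of `T` there is a sequence
`(b_i)` of parameters with `φ(M, b_i)` strictly contained in `φ(M, b_{i+1})` for every `i`. -/
def HasSOP {r s : ℕ} (φ : L.Formula (Fin r ⊕ Fin s)) : Prop :=
  ∃ (M : FirstOrder.Language.Theory.ModelType.{u, v, max u v} T) (b : ℕ → Fin s → M),
    ∀ i, formulaInstance φ (b i) ⊂ formulaInstance φ (b (i + 1))

/-- A theory is NSOP if no formula has the strict order property. -/
def NSOP : Prop :=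
  ∀ (r s : ℕ) (φ : L.Formula (Fin r ⊕ Fin s)), ¬ HasSOP T φ

end Theories

end SymbolicNSOP

/-! Write `c n` for `σ ^ n (b)`. The coordinate of a symbolic representation at `n` tells whether
`φ(a, c (-n))` holds (`mem_symbolicRep_iff`), so the symbolic image records which patterns of
instances along the indiscernible sequence `c` are realized. Shift-closure is automatic; only the
switch has content.

Suppose T is NSOP. By saturation it is enough to switch finite patterns. If a finite pattern holding
at `p` and failing at `p + 1` is realized but its switch is not, drop the condition at `p + 1`. By
indiscernibility, moving the index `p` to the right through a gap strictly shrinks the set defined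
by the remaining conditions, and gaps of any length are available. Compactness turns these finite
chains into the strict order property (`RealizesPattern.swap_of_and_not`,
`not_nsop_of_finite_chains`).

Conversely, let `φ(M, b i)` be strictly increasing. An average type along iterated ultrafilters
yields an indiscernible sequence indexed by `ℤ`, still with strictly increasing instances, in any
saturated model elementarily equivalent to M. Strong homogeneity gives an automorphism moving the
sequence one step. Symbolic representations are then monotone, whereas switching one that contains 0
but not 1 gives a set containing 1 but not 0 (`not_symbolicImagesSWClosed`).

The converse needs a saturated and strongly homogeneous model (`exists_saturated_homogeneous`). It
is built from syntactic names, of type `Code`: every realization of a type over a named sequence,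
and every value of a required automorphism, has a name in advance. Zorn's lemma and compactness
provide a model in which all names have their intended meaning, and the named elements form the
desired model. -/

namespace SymbolicNSOP

open FirstOrder.Language

universe x y z

/-! ### Finite conjunctions, free variables and finite satisfiability -/

section Formulas

variable {L : FirstOrder.Language.{u, v}} {V : Type x} {M : Type y} [L.Structure M]

/-- The conjunction of a finite set of formulas. -/
noncomputable def conj (q : Set (L.Formula V)) (hq : q.Finite) : L.Formula V :=
  have := hq.to_subtype
  Formula.iInf fun φ : q => φ.1

theorem realize_conj {q : Set (L.Formula V)} (hq : q.Finite) {a : V → M} :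
    (conj q hq).Realize a ↔ ∀ φ ∈ q, φ.Realize a := by
  have := hq.to_subtype
  simp [conj, Formula.realize_iInf]

/-- The formula `φ`, seen as a formula in its own free variables. -/
noncomputable def restrictToFree [DecidableEq V] (φ : L.Formula V) :
    L.Formula φ.freeVarFinset :=
  BoundedFormula.restrictFreeVar φ id

theorem realize_restrictToFree [DecidableEq V] (φ : L.Formula V) {a : V → M}
    {b : φ.freeVarFinset → M} (h : ∀ i, b i = a i) :
    (restrictToFree φ).Realize b ↔ φ.Realize a :=
  BoundedFormula.realize_restrictFreeVar _ h

theorem realize_congr_freeVars [DecidableEq V] (φ : L.Formula V) {a b : V → M}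
    (h : ∀ i ∈ φ.freeVarFinset, a i = b i) : φ.Realize a ↔ φ.Realize b := by
  rw [← realize_restrictToFree φ (b := fun i => a i) (fun _ => rfl),
    realize_restrictToFree φ fun i => h i i.2]

theorem realize_exClosure_iff [DecidableEq V] [Nonempty M] (φ : L.Formula V) :
    M ⊨ φ.exClosure ↔ ∃ a : V → M, φ.Realize a := by
  rw [Formula.realize_exClosure]
  constructor
  · rintro ⟨b, hb⟩
    refine ⟨fun i => if h : i ∈ φ.freeVarFinset then b ⟨i, h⟩ else Classical.arbitrary M, ?_⟩
    exact (realize_restrictToFree φ (b := b) fun i => by simp).1 hb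
  · rintro ⟨a, ha⟩
    exact ⟨fun i => a i, (realize_restrictToFree φ fun _ => rfl).2 ha⟩

theorem exists_realize_iff {N : Type z} [L.Structure N] [Nonempty M] [Nonempty N]
    (h : M ≅[L] N) (φ : L.Formula V) :
    (∃ a : V → M, φ.Realize a) ↔ ∃ a : V → N, φ.Realize a := by
  classical
  rw [← realize_exClosure_iff, ← realize_exClosure_iff]
  exact h.realize_sentence _

/-- A set of formulas is finitely satisfiable in `M`. -/
def FinSat (M : Type y) [L.Structure M] (Γ : Set (L.Formula V)) : Prop :=
  ∀ q ⊆ Γ, q.Finite → ∃ a : V → M, ∀ φ ∈ q, φ.Realize a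

theorem FinSat.of_elementarilyEquivalent {N : Type z} [L.Structure N] [Nonempty M] [Nonempty N]
    (h : M ≅[L] N) {Γ : Set (L.Formula V)} (hΓ : FinSat M Γ) : FinSat N Γ := by
  intro q hq hf
  obtain ⟨a, ha⟩ := hΓ q hq hf
  obtain ⟨b, hb⟩ := (exists_realize_iff h (conj q hf)).1 ⟨a, (realize_conj hf).2 ha⟩
  exact ⟨b, (realize_conj hf).1 hb⟩

/-- A set of formulas in the free variable `x`, with parameters `a`, is finitely satisfiable. -/
def FinSatOver {W : Type z} (a : V → M) (p : Set (L.Formula (V ⊕ W))) : Prop :=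
  ∀ q ⊆ p, q.Finite → ∃ y : W → M, ∀ φ ∈ q, φ.Realize (Sum.elim a y)

theorem FinSatOver.congr {N : Type z} [L.Structure N] {W : Type w} [Finite W] {a : V → M}
    {b : V → N} (h : ∀ φ : L.Formula V, φ.Realize a → φ.Realize b)
    {p : Set (L.Formula (V ⊕ W))} (hp : FinSatOver a p) : FinSatOver b p := by
  intro q hq hf
  obtain ⟨y, hy⟩ := hp q hq hf
  have := h ((conj q hf).iExs W)
  simp only [Formula.realize_iExs, realize_conj] at this
  exact this ⟨y, hy⟩

end Formulas

/-- Compactness for sets of formulas. -/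
theorem exists_model_realize {L : FirstOrder.Language.{u, v}} {T : L.Theory} {V : Type z}
    (Γ : Set (L.Formula V))
    (h : ∀ q ⊆ Γ, q.Finite → ∃ (M : Theory.ModelType.{u, v, x} T) (a : V → M),
      ∀ φ ∈ q, φ.Realize a) :
    ∃ (M : Theory.ModelType.{u, v, max u v z} T) (a : V → M), ∀ φ ∈ Γ, φ.Realize a := by
  classical
  have hs : ((L.lhomWithConstants V).onTheory T ∪
      Formula.equivSentence '' Γ : L[[V]].Theory).IsSatisfiable := by
    rw [Theory.isSatisfiable_iff_isFinitelySatisfiable]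
    intro T0 hT0
    obtain ⟨M, a, ha⟩ := h {φ | φ ∈ Γ ∧ Formula.equivSentence φ ∈ T0} (fun _ h => h.1)
      ((T0.finite_toSet.preimage Formula.equivSentence.injective.injOn).subset fun _ h => h.2)
    let : (constantsOn V).Structure M := constantsOn.structure a
    have hM : M ⊨ (T0 : L[[V]].Theory) := by
      refine ⟨fun φ hφ => ?_⟩
      rcases hT0 hφ with h1 | ⟨ψ, hψ, rfl⟩
      · exact ((LHom.onTheory_model (L.lhomWithConstants V) T).2 inferInstance).realize_of_mem φ h1
      · rw [Formula.realize_equivSentence]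
        exact ha ψ ⟨hψ, hφ⟩
    exact Theory.Model.isSatisfiable M
  obtain ⟨N⟩ := hs
  have h1 : N ⊨ (L.lhomWithConstants V).onTheory T :=
    Theory.Model.mono N.is_model Set.subset_union_left
  let N1 : ((L.lhomWithConstants V).onTheory T).ModelType := Theory.ModelType.of _ N
  refine ⟨N1.reduct (L.lhomWithConstants V), fun i => ((L.con i : L[[V]].Constants) : N), ?_⟩
  intro φ hφ
  have h2 := N.is_model.realize_of_mem (Formula.equivSentence φ) (Or.inr ⟨φ, hφ, rfl⟩)
  let : L.Structure N := (L.lhomWithConstants V).reduct N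
  have := LHom.isExpansionOn_reduct (L.lhomWithConstants V) N
  exact (Formula.realize_equivSentence N φ).1 h2

/-- Names for the elements of a saturated homogeneous model: `wit A p` names a realization of the
type `p` over the sequence named by `A`, and `sig t a b c` the image of `c` under an automorphism
mapping `a` to `b`; the automorphisms of index `t` from `a` to `b` and of index `!t` from `b` to `a`
will be inverse to each other. -/
inductive Code (L : FirstOrder.Language.{u, v}) : Type (max u v w)
  | base : Code L
  | wit (A : ℕ → Code L) (p : Set (L.Formula (ℕ ⊕ Fin 1))) : Code L
  | sig (t : Bool) (a b : ℕ → Code L) (c : Code L) : Code L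

/-! ### Relations between names that are elementary maps -/

section Relations

variable {L : FirstOrder.Language.{u, v}} {C : Type x} {M : Type y} [L.Structure M]
  {N : Type z} [L.Structure N]

variable (L) in
/-- Interpreting names by `e`, the relation `R` preserves all formulas. -/
def PreservesFormulas (R : C → C → Prop) (e : C → M) : Prop :=
  ∀ ψ : L.Formula {p : C × C // R p.1 p.2},
    ψ.Realize (fun p => e p.1.1) → ψ.Realize (fun p => e p.1.2)

theorem PreservesFormulas.realize_iff {R : C → C → Prop} {e : C → M}
    (h : PreservesFormulas L R e) {ι : Type w} {f g : ι → C} (hR : ∀ i, R (f i) (g i))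
    (ψ : L.Formula ι) : ψ.Realize (fun i => e (f i)) ↔ ψ.Realize (fun i => e (g i)) := by
  have key : ∀ χ : L.Formula ι, χ.Realize (fun i => e (f i)) → χ.Realize (fun i => e (g i)) := by
    intro χ hχ
    have := h (χ.relabel fun i => ⟨(f i, g i), hR i⟩)
    simp only [Formula.realize_relabel] at this
    exact this hχ
  refine ⟨key ψ, fun h1 => ?_⟩
  by_contra h2
  exact (key ψ.not h2) h1

theorem PreservesFormulas.mono {R R' : C → C → Prop} {e : C → M}
    (h : PreservesFormulas L R e) (hR : ∀ c d, R' c d → R c d) : PreservesFormulas L R' e :=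
  fun ψ => (h.realize_iff (f := fun p => p.1.1) (g := fun p => p.1.2)
    (fun p => hR _ _ p.2) ψ).1

theorem PreservesFormulas.flip {R R' : C → C → Prop} {e : C → M}
    (h : PreservesFormulas L R e) (hR : ∀ c d, R' c d → R d c) : PreservesFormulas L R' e :=
  fun ψ => (h.realize_iff (f := fun p => p.1.2) (g := fun p => p.1.1)
    (fun p => hR _ _ p.2) ψ).2

/-- A formula mentions only finitely many pairs, so preservation is a local property. This is what
lets it pass to the union of a chain. -/
theorem PreservesFormulas.of_finset {R : C → C → Prop} {e : C → M}
    (h : ∀ s : Finset (C × C), (∀ p ∈ s, R p.1 p.2) →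
      ∃ R' : C → C → Prop, (∀ p ∈ s, R' p.1 p.2) ∧ PreservesFormulas L R' e) :
    PreservesFormulas L R e := by
  classical
  intro ψ hψ
  obtain ⟨R', h1, h2⟩ := h (ψ.freeVarFinset.map (Function.Embedding.subtype _)) (by
    intro p hp
    simp only [Finset.mem_map, Function.Embedding.subtype_apply] at hp
    obtain ⟨p, -, rfl⟩ := hp
    exact p.2)
  have h3 := (h2.realize_iff (f := fun i : ψ.freeVarFinset => i.1.1.1) (g := fun i => i.1.1.2)
    (fun i => h1 i.1.1 (Finset.mem_map_of_mem (Function.Embedding.subtype _) i.2)) (restrictToFree ψ))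
  rw [realize_restrictToFree ψ (a := fun p => e p.1.1) (fun _ => rfl),
    realize_restrictToFree ψ (a := fun p => e p.1.2) (fun _ => rfl)] at h3
  exact h3.1 hψ

variable (L) in
/-- The interpretations `e` and `e'` give the same type to the names in `S`. -/
def Agree (S : Set C) (e : C → M) (e' : C → N) : Prop :=
  ∀ φ : L.Formula S, φ.Realize (fun s => e s) → φ.Realize (fun s => e' s)

theorem Agree.realize_iff {S : Set C} {e : C → M} {e' : C → N} (h : Agree L S e e')
    {ι : Type w} {c : ι → C} (hc : ∀ i, c i ∈ S) (φ : L.Formula ι) :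
    φ.Realize (fun i => e (c i)) ↔ φ.Realize (fun i => e' (c i)) := by
  have key : ∀ χ : L.Formula ι, χ.Realize (fun i => e (c i)) → χ.Realize (fun i => e' (c i)) := by
    intro χ hχ
    have := h (χ.relabel fun i => ⟨c i, hc i⟩)
    simp only [Formula.realize_relabel] at this
    exact this hχ
  refine ⟨key φ, fun h1 => ?_⟩
  by_contra h2
  exact (key φ.not h2) h1

theorem Agree.preservesFormulas {S : Set C} {e : C → M} {e' : C → N} (h : Agree L S e e')
    {R : C → C → Prop} (hR : ∀ c d, R c d → c ∈ S ∧ d ∈ S) (hp : PreservesFormulas L R e) :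
    PreservesFormulas L R e' := by
  intro ψ hψ
  rw [← h.realize_iff (c := fun p : {p : C × C // R p.1 p.2} => p.1.2)
    (fun p => (hR _ _ p.2).2) ψ]
  apply hp
  rwa [h.realize_iff (c := fun p : {p : C × C // R p.1 p.2} => p.1.1)
    (fun p => (hR _ _ p.2).1) ψ]

variable (L) in
/-- Two sequences have the same type over the empty set. -/
def SameType (a b : ℕ → M) : Prop :=
  ∀ φ : L.Formula ℕ, φ.Realize a ↔ φ.Realize b

end Relations

/-! ### Interpretations giving names their intended meaning -/

section Good

variable {L : FirstOrder.Language.{u, v}} {M : Type y} [L.Structure M]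
  {N : Type z} [L.Structure N]

/-- The graph, on names in `S`, of the automorphism of index `t` mapping `a` to `b`. -/
def SigRel (S : Set (Code.{u, v, w} L)) (t : Bool) (a b : ℕ → Code L) (c d : Code L) : Prop :=
  (∃ n, c = a n ∧ d = b n) ∨ (d = .sig t a b c ∧ d ∈ S) ∨ (c = .sig (!t) b a d ∧ c ∈ S)

theorem SigRel.symm {S : Set (Code.{u, v, w} L)} {t : Bool} {a b : ℕ → Code L} {c d : Code L}
    (h : SigRel S t a b c d) : SigRel S (!t) b a d c := by
  rcases h with ⟨n, h1, h2⟩ | h | h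
  · exact Or.inl ⟨n, h2, h1⟩
  · exact Or.inr (Or.inr (by simpa using h))
  · exact Or.inr (Or.inl h)

/-- `S` is closed under subterms. -/
structure SubtermClosed (S : Set (Code.{u, v, w} L)) : Prop where
  wit : ∀ {A p}, .wit A p ∈ S → ∀ n, A n ∈ S
  left : ∀ {t a b c}, .sig t a b c ∈ S → ∀ n, a n ∈ S
  right : ∀ {t a b c}, .sig t a b c ∈ S → ∀ n, b n ∈ S
  arg : ∀ {t a b c}, .sig t a b c ∈ S → c ∈ S

/-- The interpretation `e` of the names in `S` is as intended. -/
structure IsGood (S : Set (Code.{u, v, w} L)) (e : Code.{u, v, w} L → M) : Prop where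
  closed : SubtermClosed S
  wit : ∀ A p, .wit A p ∈ S → FinSatOver (fun n => e (A n)) p →
    ∀ φ ∈ p, φ.Realize (Sum.elim (fun n => e (A n)) fun _ => e (.wit A p))
  sig : ∀ t a b c, .sig t a b c ∈ S → SameType L (fun n => e (a n)) (fun n => e (b n)) →
    PreservesFormulas L (SigRel S t a b) e

theorem SubtermClosed.sigRel_mem {S : Set (Code.{u, v, w} L)} (hS : SubtermClosed S) {t a b}
    (ha : ∀ n, a n ∈ S) (hb : ∀ n, b n ∈ S) {c d} (h : SigRel S t a b c d) : c ∈ S ∧ d ∈ S := by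
  rcases h with ⟨n, rfl, rfl⟩ | ⟨rfl, h⟩ | ⟨rfl, h⟩
  · exact ⟨ha n, hb n⟩
  · exact ⟨hS.arg h, h⟩
  · exact ⟨h, hS.arg h⟩

theorem SameType.symm {a b : ℕ → M} (h : SameType L a b) : SameType L b a := fun φ => (h φ).symm

theorem Agree.sameType_iff {S : Set (Code.{u, v, w} L)} {e : Code.{u, v, w} L → M}
    {e' : Code.{u, v, w} L → N} (h : Agree L S e e') {a b : ℕ → Code L} (ha : ∀ n, a n ∈ S)
    (hb : ∀ n, b n ∈ S) :
    SameType L (fun n => e (a n)) (fun n => e (b n)) ↔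
      SameType L (fun n => e' (a n)) (fun n => e' (b n)) :=
  forall_congr' fun φ => iff_congr (h.realize_iff ha φ) (h.realize_iff hb φ)

/-- Goodness speaks only of pairs `a`, `b` for which some value is already named. If none is named
in either direction, the relation is just `a n ↦ b n`, and equality of types suffices. This starts
the construction of a new automorphism. -/
theorem IsGood.preservesFormulas {S : Set (Code.{u, v, w} L)} {e : Code.{u, v, w} L → M}
    (h : IsGood S e) {t a b} (hab : SameType L (fun n => e (a n)) (fun n => e (b n))) :
    PreservesFormulas L (SigRel S t a b) e := by
  by_cases h1 : ∃ c, .sig t a b c ∈ S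
  · obtain ⟨c, hc⟩ := h1
    exact h.sig t a b c hc hab
  by_cases h2 : ∃ c, .sig (!t) b a c ∈ S
  · obtain ⟨c, hc⟩ := h2
    exact (h.sig _ b a c hc hab.symm).flip fun _ _ => SigRel.symm
  have h3 : ∀ p : {p : Code L × Code L // SigRel S t a b p.1 p.2},
      ∃ n, p.1.1 = a n ∧ p.1.2 = b n := by
    rintro ⟨⟨c, d⟩, h | ⟨h, h'⟩ | ⟨h, h'⟩⟩
    · exact h
    · exact absurd ⟨c, h ▸ h'⟩ h1
    · exact absurd ⟨d, h ▸ h'⟩ h2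
  choose f hf1 hf2 using h3
  intro ψ hψ
  have := hab (ψ.relabel f)
  simp only [Formula.realize_relabel, Function.comp_def, ← hf1, ← hf2] at this
  exact this.1 hψ

/-- Goodness depends only on the type of the named elements, so the conditions on old names survive
in the new model. Only those involving `x` need checking: its own realization property, or the one
automorphism of which it is a value. -/
theorem IsGood.insert {S : Set (Code.{u, v, w} L)} {e : Code.{u, v, w} L → M}
    {e' : Code.{u, v, w} L → N} (h : IsGood S e) (hag : Agree L S e e') {x : Code L}
    (hx : SubtermClosed (insert x S))
    (hwS : ∀ A p, x = .wit A p → ∀ n, A n ∈ S)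
    (hsS : ∀ t a b c, x = .sig t a b c → (∀ n, a n ∈ S) ∧ ∀ n, b n ∈ S)
    (hw : ∀ A p, x = .wit A p → FinSatOver (fun n => e (A n)) p →
      ∀ φ ∈ p, φ.Realize (Sum.elim (fun n => e' (A n)) fun _ => e' x))
    (hs : ∀ t a b c, x = .sig t a b c → SameType L (fun n => e (a n)) (fun n => e (b n)) →
      PreservesFormulas L (SigRel (insert x S) t a b) e') :
    IsGood (insert x S) e' where
  closed := hx
  wit A p hA hp φ hφ := by
    have hAS : ∀ n, A n ∈ S := by
      rcases hA with hA | hA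
      · exact hwS A p hA.symm
      · exact h.closed.wit hA
    have hp' : FinSatOver (fun n => e (A n)) p :=
      FinSatOver.congr (fun φ => (hag.realize_iff hAS φ).2) hp
    rcases hA with hA | hA
    · subst hA
      exact hw A p rfl hp' φ hφ
    · have h1 := h.wit A p hA hp' φ hφ
      have h2 := hag.realize_iff (c := Sum.elim A fun _ => .wit A p) (by
        rintro (n | n)
        · exact hAS n
        · exact hA) φ
      convert h2.1 (by convert h1 using 1; funext i; cases i <;> rfl) using 1
      funext i; cases i <;> rfl
  sig t a b c hc hab := by
    by_cases h1 : ∃ c', x = .sig t a b c'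
    · obtain ⟨c', h1⟩ := h1
      exact hs t a b c' h1 ((hag.sameType_iff (hsS _ _ _ _ h1).1 (hsS _ _ _ _ h1).2).2 hab)
    by_cases h2 : ∃ c', x = .sig (!t) b a c'
    · obtain ⟨c', h2⟩ := h2
      exact (hs _ b a c' h2 ((hag.sameType_iff (hsS _ _ _ _ h2).1 (hsS _ _ _ _ h2).2).2
        hab.symm)).flip fun _ _ => SigRel.symm
    have hc' : .sig t a b c ∈ S := hc.resolve_left fun h3 => h1 ⟨c, h3.symm⟩
    have ha := h.closed.left hc'
    have hb := h.closed.right hc'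
    refine PreservesFormulas.mono (hag.preservesFormulas (fun _ _ => h.closed.sigRel_mem ha hb)
      (h.sig t a b c hc' ((hag.sameType_iff ha hb).2 hab))) fun c d hcd => ?_
    rcases hcd with hcd | ⟨hcd, hd⟩ | ⟨hcd, hd⟩
    · exact Or.inl hcd
    · exact Or.inr (Or.inl ⟨hcd, hd.resolve_left fun h3 => h1 ⟨c, h3 ▸ hcd⟩⟩)
    · exact Or.inr (Or.inr ⟨hcd, hd.resolve_left fun h3 => h2 ⟨d, h3 ▸ hcd⟩⟩)

end Good

/-! ### Interpreting one more name -/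

section Extension

variable {L : FirstOrder.Language.{u, v}} {T : L.Theory}

theorem exists_finite_image_eq {α : Type x} {β : Type y} {f : α → β} {s : Set α} {t : Set β}
    (ht : t.Finite) (h : t ⊆ f '' s) : ∃ s' ⊆ s, s'.Finite ∧ f '' s' = t := by
  have h' : ∀ b : t, ∃ a, a ∈ s ∧ f a = b := fun b => h b.2
  choose g hg1 hg2 using h'
  have := ht.to_subtype
  refine ⟨Set.range g, ?_, Set.finite_range g, ?_⟩
  · rintro _ ⟨b, rfl⟩
    exact hg1 b
  · rw [← Set.range_comp]
    ext b
    simp [Set.mem_range, hg2]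

theorem agree_of_subset {C : Type x} {M : Type y} [L.Structure M] {N : Type z} [L.Structure N]
    {S S' : Set C} (hS : S ⊆ S') {e : C → M} {e' : C → N} (h : Agree L S' e e') :
    Agree L S e e' :=
  fun φ => (h.realize_iff (c := fun s : S => s.1) (fun s => hS s.2) φ).1

theorem Agree.refl {C : Type x} {M : Type y} [L.Structure M] (S : Set C) (e : C → M) :
    Agree L S e e := fun _ => id

/-- A new name can be interpreted by a realization of a finitely satisfiable type. -/
theorem exists_agree_realize {C : Type w} {M : Theory.ModelType.{u, v, x} T}
    (e : C → M) {S : Set C} {c : C} (hc : c ∉ S) {P : Set (L.Formula (S ⊕ Fin 1))}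
    (hP : FinSatOver (fun s : S => e s) P) :
    ∃ (N : Theory.ModelType.{u, v, max u v w} T) (e' : C → N), Agree L S e e' ∧
      ∀ φ ∈ P, φ.Realize (Sum.elim (fun s : S => e' s) fun _ => e' c) := by
  classical
  let g : L.Formula S → L.Formula C := fun φ => φ.relabel (↑)
  let g' : L.Formula (S ⊕ Fin 1) → L.Formula C :=
    fun φ => φ.relabel (Sum.elim (↑) fun _ => c)
  obtain ⟨N, e', h⟩ := exists_model_realize (T := T)
    (g '' {φ | φ.Realize fun s => e s} ∪ g' '' P) (by
      intro q hq hf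
      obtain ⟨P', hP', hf', hqP⟩ : ∃ P' ⊆ P, P'.Finite ∧ q ∩ g' '' P ⊆ g' '' P' := by
        obtain ⟨P', h1, h2, h3⟩ := exists_finite_image_eq (f := g') (s := P)
          (t := q ∩ g' '' P) (hf.inter_of_left _) Set.inter_subset_right
        exact ⟨P', h1, h2, h3.ge⟩
      obtain ⟨y, hy⟩ := hP P' hP' hf'
      have hne : ∀ s : S, Function.update e c (y 0) s = e s := fun s =>
        Function.update_of_ne (fun h : s.1 = c => hc (h ▸ s.2)) _ _
      refine ⟨M, Function.update e c (y 0), fun φ hφ => ?_⟩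
      rcases hq hφ with ⟨ψ, hψ, rfl⟩ | hφ'
      · simp only [g, Formula.realize_relabel, Function.comp_def, hne]
        exact hψ
      · obtain ⟨ψ, hψ, rfl⟩ := hqP ⟨hφ, hφ'⟩
        simp only [g', Formula.realize_relabel]
        convert hy ψ hψ using 1
        funext i
        rcases i with s | i
        · exact hne s
        · simp [Subsingleton.elim i 0])
  refine ⟨N, e', fun φ hφ => ?_, fun φ hφ => ?_⟩
  · have := h _ (Or.inl ⟨φ, hφ, rfl⟩)
    simpa only [g, Formula.realize_relabel, Function.comp_def] using this
  · have := h _ (Or.inr ⟨φ, hφ, rfl⟩)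
    simp only [g', Formula.realize_relabel] at this
    convert this using 1
    funext i; cases i <;> rfl

/-- One step of an elementary map: the type of `e c` can be transported along `R`. -/
theorem PreservesFormulas.finSatOver {C : Type x} {M : Type y} [L.Structure M] {S : Set C}
    {e : C → M} {R : C → C → Prop} (hp : PreservesFormulas L R e) (hR : ∀ c d, R c d → d ∈ S)
    (m : Fin 1 → M) :
    FinSatOver (fun s : S => e s)
      ((fun ψ : L.Formula ({p : C × C // R p.1 p.2} ⊕ Fin 1) =>
        ψ.relabel (Sum.map (fun p => (⟨p.1.2, hR _ _ p.2⟩ : S)) id)) ''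
        {ψ | ψ.Realize (Sum.elim (fun p => e p.1.1) m)}) := by
  intro q hq hf
  obtain ⟨q', h1, h2, rfl⟩ := exists_finite_image_eq hf hq
  have := hp ((conj q' h2).iExs (Fin 1))
  simp only [Formula.realize_iExs, realize_conj] at this
  obtain ⟨y, hy⟩ := this ⟨m, fun φ hφ => h1 hφ⟩
  refine ⟨y, ?_⟩
  rintro _ ⟨ψ, hψ, rfl⟩
  simp only [Formula.realize_relabel]
  convert hy ψ hψ using 1
  funext i; cases i <;> rfl

/-- The successor step of the construction. A witness realizes its type; the image of `c` realizes
the type of `e c` transported along the part of the automorphism already named. Both types are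
finitely satisfiable, so compactness applies. -/
theorem exists_isGood_insert {M : Theory.ModelType.{u, v, max u v w} T}
    {e : Code.{u, v, w} L → M} {S : Set (Code.{u, v, w} L)} (h : IsGood S e)
    {x : Code.{u, v, w} L} (hxS : x ∉ S)
    (hwS : ∀ A p, x = .wit A p → ∀ n, A n ∈ S)
    (hsS : ∀ t a b c, x = .sig t a b c → (∀ n, a n ∈ S) ∧ (∀ n, b n ∈ S) ∧ c ∈ S) :
    ∃ (N : Theory.ModelType.{u, v, max u v w} T) (e' : Code.{u, v, w} L → N),
      Agree L S e e' ∧ IsGood (insert x S) e' := by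
  classical
  have hcl : SubtermClosed (insert x S) := by
    refine ⟨?_, ?_, ?_, ?_⟩
    · intro A p hA n
      rcases hA with hA | hA
      · exact Or.inr (hwS A p hA.symm n)
      · exact Or.inr (h.closed.wit hA n)
    · intro t a b c hA n
      rcases hA with hA | hA
      · exact Or.inr ((hsS t a b c hA.symm).1 n)
      · exact Or.inr (h.closed.left hA n)
    · intro t a b c hA n
      rcases hA with hA | hA
      · exact Or.inr ((hsS t a b c hA.symm).2.1 n)
      · exact Or.inr (h.closed.right hA n)
    · intro t a b c hA
      rcases hA with hA | hA
      · exact Or.inr (hsS t a b c hA.symm).2.2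
      · exact Or.inr (h.closed.arg hA)
  -- A name whose hypothesis fails, or the base name, carries no obligation: the old interpretation
  -- is kept.
  have triv : ∀ (hw : ∀ A p, x = .wit A p → FinSatOver (fun n => e (A n)) p → False)
      (hs : ∀ t a b c, x = .sig t a b c →
        SameType L (fun n => e (a n)) (fun n => e (b n)) → False),
      ∃ (N : Theory.ModelType.{u, v, max u v w} T) (e' : Code.{u, v, w} L → N),
        Agree L S e e' ∧ IsGood (insert x S) e' := fun hw hs =>
    ⟨M, e, Agree.refl S e, h.insert (Agree.refl S e) hcl hwS
      (fun t a b c hx => ⟨(hsS t a b c hx).1, (hsS t a b c hx).2.1⟩)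
      (fun A p hA hp => (hw A p hA hp).elim) (fun t a b c hx hab => (hs t a b c hx hab).elim)⟩
  cases x with
  | base => exact triv (fun _ _ h => by cases h) (fun _ _ _ _ h => by cases h)
  | wit A p =>
    by_cases hp : FinSatOver (fun n => e (A n)) p
    · have hA := hwS A p rfl
      obtain ⟨N, e', hag, hr⟩ := exists_agree_realize e hxS
        (P := (fun φ : L.Formula (ℕ ⊕ Fin 1) =>
          φ.relabel (Sum.map (fun n => (⟨A n, hA n⟩ : S)) id)) '' p) (by
          intro q hq hf
          obtain ⟨q', h1, h2, rfl⟩ := exists_finite_image_eq hf hq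
          obtain ⟨y, hy⟩ := hp q' h1 h2
          refine ⟨y, ?_⟩
          rintro _ ⟨ψ, hψ, rfl⟩
          simp only [Formula.realize_relabel]
          convert hy ψ hψ using 1
          funext i; cases i <;> rfl)
      refine ⟨N, e', hag, h.insert hag hcl hwS
        (fun t a b c hx => ⟨(hsS t a b c hx).1, (hsS t a b c hx).2.1⟩) ?_
        (fun _ _ _ _ h => by cases h)⟩
      rintro _ _ ⟨rfl, rfl⟩ - φ hφ
      have := hr _ ⟨φ, hφ, rfl⟩
      simp only [Formula.realize_relabel] at this
      convert this using 1
      funext i; cases i <;> rfl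
    · exact triv (fun _ _ h h' => by cases h; exact hp h') (fun _ _ _ _ h => by cases h)
  | sig t a b c =>
    by_cases hab : SameType L (fun n => e (a n)) (fun n => e (b n))
    · obtain ⟨ha, hb, hc⟩ := hsS t a b c rfl
      have hR := fun c d => h.closed.sigRel_mem (t := t) ha hb (c := c) (d := d)
      obtain ⟨N, e', hag, hr⟩ := exists_agree_realize e hxS
        ((h.preservesFormulas (t := t) hab).finSatOver (fun c d h => (hR c d h).2) fun _ => e c)
      refine ⟨N, e', hag, h.insert hag hcl hwS
        (fun t a b c hx => ⟨(hsS t a b c hx).1, (hsS t a b c hx).2.1⟩)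
        (fun _ _ h => by cases h) ?_⟩
      intro t' a' b' c' hx _
      cases hx
      set x : Code.{u, v, w} L := .sig t a b c with hx
      -- The pair `(c, x)` is the only new one. The index `t` is essential here: without it, when `a
      -- = b`, the name `x` would be both the image and the preimage of `c`.
      have hcases : ∀ p : {p : Code L × Code L // SigRel (insert x S) t a b p.1 p.2},
          p.1.2 ≠ x → SigRel S t a b p.1.1 p.1.2 := by
        rintro ⟨⟨c₁, d₁⟩, hp | ⟨hp, hp'⟩ | ⟨hp, hp'⟩⟩ hne
        · exact Or.inl hp
        · exact Or.inr (Or.inl ⟨hp, hp'.resolve_left hne⟩)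
        · refine Or.inr (Or.inr ⟨hp, hp'.resolve_left fun h1 => ?_⟩)
          exact absurd (h1.symm.trans hp) (by simp [hx])
      -- A pair ending in `x` for another reason would make `x` a subterm of a name in `S`, or an
      -- entry of `b`, contradicting `x ∉ S`.
      have heq : ∀ p : {p : Code L × Code L // SigRel (insert x S) t a b p.1 p.2},
          p.1.2 = x → p.1.1 = c := by
        rintro ⟨⟨c₁, d₁⟩, ⟨n, hp, hp'⟩ | ⟨hp, hp'⟩ | ⟨hp, hp'⟩⟩ hne
        · exact absurd (hb n) (by rw [← hp', hne]; exact hxS)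
        · simp only [hx] at hne hp
          rw [hne] at hp
          cases hp; rfl
        · rcases hp' with hp' | hp'
          · exact absurd (hp'.symm.trans hp) (by simp [hx])
          · exact absurd (h.closed.arg (show Code.sig (!t) b a d₁ ∈ S from hp ▸ hp'))
              (by rw [show d₁ = x from hne]; exact hxS)
      intro ψ hψ
      let f : {p : Code L × Code L // SigRel (insert x S) t a b p.1 p.2} →
          {p : Code L × Code L // SigRel S t a b p.1 p.2} ⊕ Fin 1 := fun p =>
        if hp : p.1.2 = x then Sum.inr 0 else Sum.inl ⟨p.1, hcases p hp⟩
      have h1 : (ψ.relabel f).Realize (Sum.elim (fun p => e p.1.1) fun _ => e c) := by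
        have h2 := (hag.realize_iff
          (c := fun p : {p : Code L × Code L // SigRel (insert x S) t a b p.1 p.2} => p.1.1) (by
          intro p
          by_cases hp : p.1.2 = x
          · rw [heq p hp]; exact hc
          · exact (hR _ _ (hcases p hp)).1) ψ).2 hψ
        rw [Formula.realize_relabel]
        convert h2 using 1
        funext p
        by_cases hp : p.1.2 = x
        · simp [f, hp, heq p hp]
        · simp [f, hp]
      have h2 := hr _ ⟨_, h1, rfl⟩
      simp only [Formula.realize_relabel] at h2
      convert h2 using 1
      funext p
      by_cases hp : p.1.2 = x
      · simp [f, hp]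
      · simp [f, hp]
    · exact triv (fun _ _ h => by cases h) (fun _ _ _ _ h h' => by cases h; exact hab h')

end Extension

/-! ### Saturation over sequences, and automorphisms from relations -/

section Saturation

variable {L : FirstOrder.Language.{u, v}} {M : Type y} [L.Structure M]

theorem realize_constantsVarsEquiv_formula {A : Set M} {W : Type z} (φ : L[[A]].Formula W)
    {m : W → M} :
    Formula.Realize (BoundedFormula.constantsVarsEquiv φ : L.Formula (A ⊕ W)) (Sum.elim (↑) m) ↔
      φ.Realize m := by
  have := BoundedFormula.realize_constantsVarsEquiv (M := M) (φ := φ) (v := m) (xs := default)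
  simpa [Formula.Realize] using this

theorem aleph1Saturated_iff [Nonempty M] :
    Aleph1Saturated L M ↔ ∀ (a : ℕ → M) (p : Set (L.Formula (ℕ ⊕ Fin 1))), FinSatOver a p →
      ∃ m : Fin 1 → M, ∀ φ ∈ p, φ.Realize (Sum.elim a m) := by
  classical
  constructor
  · intro h a p hp
    let g : L.Formula (ℕ ⊕ Fin 1) → L[[Set.range a]].Formula (Fin 1) := fun φ =>
      BoundedFormula.constantsVarsEquiv.symm
        (φ.relabel (Sum.map (fun n => (⟨a n, n, rfl⟩ : Set.range a)) id))
    have hg : ∀ φ (m : Fin 1 → M), (g φ).Realize m ↔ φ.Realize (Sum.elim a m) := by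
      intro φ m
      rw [← realize_constantsVarsEquiv_formula]
      simp only [g, Equiv.apply_symm_apply]
      rw [Formula.realize_relabel]
      apply iff_of_eq
      congr 1
      funext i; cases i <;> rfl
    obtain ⟨m, hm⟩ := h (Set.range a) (Set.countable_range a) (g '' p) (by
      intro q hq hf
      obtain ⟨q', h1, h2, rfl⟩ := exists_finite_image_eq hf hq
      obtain ⟨m, hm⟩ := hp q' h1 h2
      refine ⟨m, ?_⟩
      rintro _ ⟨φ, hφ, rfl⟩
      exact (hg φ m).2 (hm φ hφ))
    exact ⟨m, fun φ hφ => (hg φ m).1 (hm _ ⟨φ, hφ, rfl⟩)⟩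
  · intro h A hA p hp
    have := hA.to_subtype
    obtain ⟨i, hi⟩ := exists_injective_nat A
    let a : ℕ → M := Function.extend i (↑) fun _ => Classical.arbitrary M
    have ha : ∀ x : A, a (i x) = x := fun x => hi.extend_apply _ _ _
    let g : L[[A]].Formula (Fin 1) → L.Formula (ℕ ⊕ Fin 1) := fun φ =>
      Formula.relabel (Sum.map i id) (BoundedFormula.constantsVarsEquiv φ)
    have hg : ∀ φ (m : Fin 1 → M), (g φ).Realize (Sum.elim a m) ↔ φ.Realize m := by
      intro φ m
      rw [← realize_constantsVarsEquiv_formula, Formula.realize_relabel]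
      apply iff_of_eq
      congr 1
      funext j; cases j
      · exact ha _
      · rfl
    obtain ⟨m, hm⟩ := h a (g '' p) (by
      intro q hq hf
      obtain ⟨q', h1, h2, rfl⟩ := exists_finite_image_eq hf hq
      obtain ⟨m, hm⟩ := hp q' h1 h2
      refine ⟨m, ?_⟩
      rintro _ ⟨φ, hφ, rfl⟩
      exact (hg φ m).2 (hm φ hφ))
    exact ⟨m, fun φ hφ => (hg φ m).1 (hm _ ⟨φ, hφ, rfl⟩)⟩

/-- A relation between names which is total in both directions and preserves all formulas
induces an automorphism. -/
theorem exists_equiv_of_preservesFormulas {C : Type x} {e : C → M} (he : Function.Surjective e)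
    {R : C → C → Prop} (hR : PreservesFormulas L R e) (h₁ : ∀ c, ∃ d, R c d)
    (h₂ : ∀ d, ∃ c, R c d) : ∃ σ : M ≃[L] M, ∀ c d, R c d → σ (e c) = e d := by
  choose F hF using he
  choose f hf using h₁
  choose g hg using h₂
  have wd : ∀ {c d c' d'}, R c d → R c' d' → (e c = e c' ↔ e d = e d') := by
    intro c d c' d' h h'
    have := hR.realize_iff (f := fun i : Bool => cond i c c') (g := fun i => cond i d d')
      (by rintro (_ | _) <;> assumption)
      ((Term.var true).equal (Term.var false) : L.Formula Bool)
    simpa using this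
  let τ : M → M := fun m => e (f (F m))
  refine ⟨⟨⟨τ, fun m => e (g (F m)), ?_, ?_⟩, ?_, ?_⟩, ?_⟩
  · intro m
    exact ((wd (hg _) (hf (F m))).2 (hF _)).trans (hF m)
  · intro m
    exact ((wd (hf _) (hg (F m))).1 (hF _)).trans (hF m)
  · intro n φ m
    have := hR.realize_iff (f := fun i : Option (Fin n) => i.elim (F (Structure.funMap φ m)) fun j => F (m j))
      (g := fun i => i.elim (f (F (Structure.funMap φ m))) fun j => f (F (m j)))
      (by rintro (_ | _) <;> exact hf _)
      ((Term.var none).equal (Term.func φ fun j => Term.var (some j)))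
    simp only [Formula.realize_equal, Term.realize_var, Term.realize_func, Option.elim, hF,
      true_iff] at this
    exact this
  · intro n r m
    have := hR.realize_iff (f := fun i : Fin n => F (m i)) (g := fun i => f (F (m i)))
      (fun _ => hf _) (r.formula fun j => Term.var j)
    simp only [Formula.realize_rel, Term.realize_var, hF] at this
    exact this.symm
  · intro c d h
    exact (wd (hf _) h).1 (hF _)

end Saturation

/-! ### Interpreting all names by Zorn's lemma -/

section Zorn

variable {L : FirstOrder.Language.{u, v}} (T : L.Theory)

/-- A good interpretation of some of the names in a model of `T`. -/
structure PartialModel where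
  /-- The model. -/
  model : Theory.ModelType.{u, v, max u v w} T
  /-- The names which are interpreted. -/
  dom : Set (Code.{u, v, w} L)
  /-- The interpretation. -/
  interp : Code.{u, v, w} L → model
  good : IsGood dom interp

/-- Only types of named elements are compared; no embedding of models is required. Upper bounds of
chains therefore come from compactness rather than from direct limits. -/
instance : Preorder (PartialModel.{u, v, w} T) where
  le X Y := X.dom ⊆ Y.dom ∧ Agree L X.dom X.interp Y.interp
  le_refl X := ⟨Set.Subset.rfl, Agree.refl _ _⟩
  le_trans X Y Z h h' := ⟨h.1.trans h'.1, fun φ hφ => agree_of_subset h.1 h'.2 φ (h.2 φ hφ)⟩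

variable {T}

theorem exists_upper_bound {c : Set (PartialModel.{u, v, w} T)} (hc : IsChain (· ≤ ·) c)
    (hne : c.Nonempty) {ι : Type x} [Finite ι] (f : ι → c) : ∃ Z ∈ c, ∀ i, (f i).1 ≤ Z := by
  have := hne.to_subtype
  obtain ⟨Z, hZ⟩ := (IsChain.directed (f := id) (r := (· ≤ ·)) hc).finite_le f
  exact ⟨Z, Z.2, hZ⟩

theorem PartialModel.bddAbove_of_isChain (c : Set (PartialModel.{u, v, w} T))
    (hc : IsChain (· ≤ ·) c) (hne : c.Nonempty) : BddAbove c := by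
  classical
  let S : Set (Code.{u, v, w} L) := ⋃ X ∈ c, X.dom
  have hS : ∀ {d}, d ∈ S ↔ ∃ X ∈ c, d ∈ X.dom := by simp [S]
  obtain ⟨N, e, h⟩ := exists_model_realize (T := T)
    (⋃ X : c, Formula.relabel (Subtype.val : X.1.dom → Code.{u, v, w} L) ''
      {φ | φ.Realize fun s => X.1.interp s}) (by
      intro q hq hf
      have := hf.to_subtype
      have h1 : ∀ φ : q, ∃ X : c, φ.1 ∈ Formula.relabel (Subtype.val : X.1.dom → Code.{u, v, w} L) ''
          {φ | φ.Realize fun s => X.1.interp s} := fun φ => by simpa using hq φ.2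
      choose X hX using h1
      obtain ⟨Z, -, hZ⟩ := exists_upper_bound hc hne X
      refine ⟨Z.model, Z.interp, fun φ hφ => ?_⟩
      obtain ⟨ψ, hψ, h3⟩ := hX ⟨φ, hφ⟩
      rw [← show _ = φ from h3, Formula.realize_relabel]
      exact (hZ ⟨φ, hφ⟩).2 ψ hψ)
  have hag : ∀ X ∈ c, Agree L X.dom X.interp e := by
    intro X hX φ hφ
    have := h (φ.relabel Subtype.val) (Set.mem_iUnion.2 ⟨⟨X, hX⟩, φ, hφ, rfl⟩)
    rwa [Formula.realize_relabel] at this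
  have hgood : IsGood S e := by
    refine ⟨⟨?_, ?_, ?_, ?_⟩, ?_, ?_⟩
    · intro A p hA n
      obtain ⟨X, hX, h1⟩ := hS.1 hA
      exact hS.2 ⟨X, hX, X.good.closed.wit h1 n⟩
    · intro t a b d hA n
      obtain ⟨X, hX, h1⟩ := hS.1 hA
      exact hS.2 ⟨X, hX, X.good.closed.left h1 n⟩
    · intro t a b d hA n
      obtain ⟨X, hX, h1⟩ := hS.1 hA
      exact hS.2 ⟨X, hX, X.good.closed.right h1 n⟩
    · intro t a b d hA
      obtain ⟨X, hX, h1⟩ := hS.1 hA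
      exact hS.2 ⟨X, hX, X.good.closed.arg h1⟩
    · intro A p hA hp φ hφ
      obtain ⟨X, hX, h1⟩ := hS.1 hA
      have hAX := X.good.closed.wit h1
      have h2 := X.good.wit A p h1
        (FinSatOver.congr (fun φ => ((hag X hX).realize_iff hAX φ).2) hp) φ hφ
      have h3 := (hag X hX).realize_iff (c := Sum.elim A fun _ => .wit A p) (by
        rintro (n | n)
        · exact hAX n
        · exact h1) φ
      convert h3.1 (by convert h2 using 1; funext i; cases i <;> rfl) using 1
      funext i; cases i <;> rfl
    · intro t a b d hd hab
      obtain ⟨X₀, hX₀, h0⟩ := hS.1 hd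
      refine PreservesFormulas.of_finset fun s hs => ?_
      have h1 : ∀ p : s, ∃ X : c, SigRel X.1.dom t a b p.1.1 p.1.2 := by
        intro p
        rcases hs p.1 p.2 with hp | ⟨hp, hp'⟩ | ⟨hp, hp'⟩
        · exact ⟨⟨X₀, hX₀⟩, Or.inl hp⟩
        · obtain ⟨X, hX, h2⟩ := hS.1 hp'
          exact ⟨⟨X, hX⟩, Or.inr (Or.inl ⟨hp, h2⟩)⟩
        · obtain ⟨X, hX, h2⟩ := hS.1 hp'
          exact ⟨⟨X, hX⟩, Or.inr (Or.inr ⟨hp, h2⟩)⟩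
      choose X hX using h1
      obtain ⟨Z, hZ, hle⟩ := exists_upper_bound hc hne
        (fun i : Option s => i.elim ⟨X₀, hX₀⟩ X)
      have h0Z := (hle none).1 h0
      have ha := Z.good.closed.left h0Z
      have hb := Z.good.closed.right h0Z
      refine ⟨SigRel Z.dom t a b, fun p hp => ?_,
        (hag Z hZ).preservesFormulas (fun _ _ => Z.good.closed.sigRel_mem ha hb)
          (Z.good.preservesFormulas (((hag Z hZ).sameType_iff ha hb).2 hab))⟩
      have hle' := (hle (some ⟨p, hp⟩)).1
      exact (hX ⟨p, hp⟩).imp id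
        (Or.imp (And.imp id fun h => hle' h) (And.imp id fun h => hle' h))
  exact ⟨⟨N, S, e, hgood⟩, fun X hX =>
    ⟨fun d hd => hS.2 ⟨X, hX, hd⟩, hag X hX⟩⟩

/-- Every satisfiable theory has a model in which all names are interpreted as intended. -/
theorem exists_isGood_univ (hT : T.IsSatisfiable) :
    ∃ (N : Theory.ModelType.{u, v, max u v w} T) (e : Code.{u, v, w} L → N),
      IsGood Set.univ e := by
  -- Compactness for an empty set of formulas moves a model of `T` into the universe `max u v w`.
  obtain ⟨N₀, -, -⟩ := exists_model_realize.{u, v, max u v, w} (T := T) (V := PEmpty.{w + 1}) ∅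
    (fun q hq _ => ⟨hT.some, PEmpty.elim, fun φ hφ => (hq hφ).elim⟩)
  have : Nonempty (PartialModel.{u, v, w} T) := ⟨⟨N₀, ∅, fun _ => Classical.arbitrary N₀,
    ⟨⟨fun h => h.elim, fun h => h.elim, fun h => h.elim, fun h => h.elim⟩,
      fun _ _ h => h.elim, fun _ _ _ _ h => h.elim⟩⟩⟩
  obtain ⟨X, hX⟩ := zorn_le_nonempty (PartialModel.bddAbove_of_isChain (T := T))
  have step : ∀ {x : Code.{u, v, w} L}, (∀ A p, x = .wit A p → ∀ n, A n ∈ X.dom) →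
      (∀ t a b c, x = .sig t a b c → (∀ n, a n ∈ X.dom) ∧ (∀ n, b n ∈ X.dom) ∧ c ∈ X.dom) →
      x ∈ X.dom := by
    intro x h1 h2
    by_contra hx
    obtain ⟨N, e', hag, hg⟩ := exists_isGood_insert X.good hx h1 h2
    exact hx ((hX (b := ⟨N, _, e', hg⟩) ⟨Set.subset_insert _ _, hag⟩).1 (Set.mem_insert _ _))
  have hall : ∀ x, x ∈ X.dom := by
    intro x
    induction x with
    | base => exact step (fun _ _ h => by cases h) (fun _ _ _ _ h => by cases h)
    | wit A p ih => exact step (fun _ _ h => by cases h; exact ih) (fun _ _ _ _ h => by cases h)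
    | sig t a b c iha ihb ihc =>
      exact step (fun _ _ h => by cases h)
        (fun _ _ _ _ h => by cases h; exact ⟨iha, ihb, ihc⟩)
  refine ⟨X.model, X.interp, ?_⟩
  rw [← Set.eq_univ_of_forall hall]
  exact X.good

end Zorn

theorem exists_extend_names {L : FirstOrder.Language.{u, v}} {N : Type z}
    {e : Code.{u, v, w} L → N} {n : ℕ} (x : Fin n → N) (hx : ∀ i, x i ∈ Set.range e) :
    ∃ A : ℕ → Code.{u, v, w} L, ∀ i : Fin n, e (A i) = x i := by
  choose c hc using hx
  exact ⟨fun k => if h : k < n then c ⟨k, h⟩ else .base, fun i => by simp [hc]⟩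

/-! ### The substructure of named elements -/

section Range

variable {L : FirstOrder.Language.{u, v}} {N : Type z} [L.Structure N]
  {e : Code.{u, v, w} L → N}

theorem IsGood.exists_realize (h : IsGood Set.univ e) (A : ℕ → Code L)
    {p : Set (L.Formula (ℕ ⊕ Fin 1))} (hp : FinSatOver (fun n => e (A n)) p) :
    ∃ c, ∀ φ ∈ p, φ.Realize (Sum.elim (fun n => e (A n)) fun _ => e c) :=
  ⟨_, h.wit A p trivial hp⟩

theorem IsGood.exists_realize_formula (h : IsGood Set.univ e) (A : ℕ → Code L)
    {φ : L.Formula (ℕ ⊕ Fin 1)} (m : N)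
    (hφ : φ.Realize (Sum.elim (fun n => e (A n)) fun _ => m)) :
    ∃ c, φ.Realize (Sum.elim (fun n => e (A n)) fun _ => e c) := by
  obtain ⟨c, hc⟩ := h.exists_realize A (p := {φ}) (fun q hq _ =>
    ⟨fun _ => m, fun ψ hψ => by rw [hq hψ]; exact hφ⟩)
  exact ⟨c, hc φ rfl⟩

/-- The elements that have a name. -/
def IsGood.rangeSubstructure (h : IsGood Set.univ e) : L.Substructure N where
  carrier := Set.range e
  fun_mem {n} f := by
    intro x hx
    obtain ⟨A, hA⟩ := exists_extend_names x hx
    obtain ⟨c, hc⟩ := h.exists_realize_formula A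
      (φ := (Term.func f fun i : Fin n => Term.var (Sum.inl i.1)).equal (Term.var (Sum.inr 0)))
      (Structure.funMap f x) (by simp [hA])
    refine ⟨c, ?_⟩
    simp [hA] at hc
    exact hc.symm

/-- The elements that have a name form an elementary substructure. -/
def IsGood.rangeElementary (h : IsGood Set.univ e) : L.ElementarySubstructure N :=
  h.rangeSubstructure.toElementarySubstructure (by
    intro n φ x a ha
    obtain ⟨A, hA⟩ := exists_extend_names (e := e) (fun i => (x i : N)) (fun i => (x i).2)
    let g : Fin (n + 1) → ℕ ⊕ Fin 1 := Fin.snoc (α := fun _ => ℕ ⊕ Fin 1) (fun i => Sum.inl i.1)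
      (Sum.inr 0)
    have key : ∀ m : N, (φ.toFormula.relabel (Sum.elim Empty.elim g)).Realize
        (Sum.elim (fun n => e (A n)) fun _ => m) ↔
        φ.Realize default (Fin.snoc ((↑) ∘ x) m : _ → N) := by
      intro m
      rw [Formula.realize_relabel, BoundedFormula.realize_toFormula]
      apply iff_of_eq
      congr 1
      · exact Subsingleton.elim _ _
      · funext i
        refine Fin.lastCases ?_ (fun i => ?_) i
        · simp [g]
        · simp [g, hA]
    obtain ⟨c, hc⟩ := h.exists_realize_formula A a ((key a).2 ha)
    exact ⟨⟨e c, c, rfl⟩, (key _).1 hc⟩)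

theorem IsGood.aleph1Saturated [Nonempty N] (h : IsGood Set.univ e) :
    Aleph1Saturated L h.rangeElementary := by
  rw [aleph1Saturated_iff]
  intro a p hp
  have ha : ∀ n, ∃ c, e c = (a n : N) := fun n => (a n).2
  choose A hA using ha
  have tr : ∀ (φ : L.Formula (ℕ ⊕ Fin 1)) (m : Fin 1 → h.rangeElementary),
      φ.Realize (Sum.elim (fun n => e (A n)) fun i => (m i : N)) ↔ φ.Realize (Sum.elim a m) := by
    intro φ m
    rw [← h.rangeElementary.subtype.map_formula]
    apply iff_of_eq
    congr 1
    funext i; cases i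
    · exact hA _
    · rfl
  obtain ⟨c, hc⟩ := h.exists_realize A (p := p) (by
    intro q hq hf
    obtain ⟨m, hm⟩ := hp q hq hf
    exact ⟨fun i => m i, fun φ hφ => (tr φ m).2 (hm φ hφ)⟩)
  exact ⟨fun _ => ⟨e c, c, rfl⟩, fun φ hφ => (tr φ _).1 (hc φ hφ)⟩

/-- The relation `SigRel` is total in both directions once all names are interpreted: `sig true A B
c` names the image of `c`, and `sig false B A c` its preimage. -/
theorem IsGood.stronglyAleph1Homogeneous (h : IsGood Set.univ e) :
    StronglyAleph1Homogeneous L h.rangeElementary := by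
  intro a b hab
  have ha : ∀ n, ∃ c, e c = (a n : N) := fun n => (a n).2
  have hb : ∀ n, ∃ c, e c = (b n : N) := fun n => (b n).2
  choose A hA using ha
  choose B hB using hb
  let e' : Code.{u, v, w} L → h.rangeElementary := fun c => ⟨e c, c, rfl⟩
  have tr : ∀ {V : Type (max u v w)} (φ : L.Formula V) (c : V → Code.{u, v, w} L),
      φ.Realize (fun i => e (c i)) ↔ φ.Realize (fun i => e' (c i)) := fun φ c =>
    h.rangeElementary.subtype.map_formula φ fun i => e' (c i)
  have hAB : SameType L (fun n => e (A n)) (fun n => e (B n)) := by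
    intro φ
    have h1 := h.rangeElementary.subtype.map_formula φ a
    have h2 := h.rangeElementary.subtype.map_formula φ b
    have h3 := h1.trans ((hab φ).trans h2.symm)
    simp only [hA, hB]
    exact h3
  obtain ⟨σ, hσ⟩ := exists_equiv_of_preservesFormulas (e := e')
    (by rintro ⟨_, c, rfl⟩; exact ⟨c, rfl⟩) (R := SigRel Set.univ true A B)
    (fun ψ hψ => (tr ψ fun p => p.1.2).1
      (h.preservesFormulas hAB ψ ((tr ψ fun p => p.1.1).2 hψ)))
    (fun c => ⟨.sig true A B c, Or.inr (Or.inl ⟨rfl, trivial⟩)⟩)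
    (fun c => ⟨.sig false B A c, Or.inr (Or.inr ⟨rfl, trivial⟩)⟩)
  refine ⟨σ, fun n => ?_⟩
  have h1 : a n = e' (A n) := Subtype.ext (hA n).symm
  have h2 : b n = e' (B n) := Subtype.ext (hB n).symm
  rw [h1, h2]
  exact hσ _ _ (Or.inl ⟨n, rfl, rfl⟩)

end Range

/-- Every satisfiable theory has an `ℵ₁`-saturated and strongly `ℵ₁`-homogeneous model. -/
theorem exists_saturated_homogeneous {L : FirstOrder.Language.{u, v}} {T : L.Theory}
    (hT : T.IsSatisfiable) : ∃ M : Theory.ModelType.{u, v, max u v w} T,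
      Aleph1Saturated L M ∧ StronglyAleph1Homogeneous L M := by
  obtain ⟨N, e, h⟩ := exists_isGood_univ.{u, v, w} hT
  exact ⟨Theory.ModelType.of T h.rangeElementary, h.aleph1Saturated, h.stronglyAleph1Homogeneous⟩

/-! ### Realizing types in countably many variables -/

section Quantify

variable {L : FirstOrder.Language.{u, v}} {M : Type y} [L.Structure M]

/-- Formulas are closed under existential quantification over arbitrary families of variables. -/
theorem exists_formula_exists [Nonempty M] {V : Type x} {W : Type z} (θ : L.Formula (V ⊕ W)) :
    ∃ χ : L.Formula V, ∀ a : V → M,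
      χ.Realize a ↔ ∃ m : W → M, θ.Realize (Sum.elim a m) := by
  classical
  let g : θ.freeVarFinset → V ⊕ θ.freeVarFinset := fun i =>
    Sum.elim Sum.inl (fun _ => Sum.inr i) i.1
  refine ⟨((restrictToFree θ).relabel g).iExs θ.freeVarFinset, fun a => ?_⟩
  rw [Formula.realize_iExs]
  simp only [Formula.realize_relabel]
  constructor
  · rintro ⟨m, hm⟩
    refine ⟨fun w => if h : Sum.inr w ∈ θ.freeVarFinset then m ⟨Sum.inr w, h⟩
      else Classical.arbitrary M, ?_⟩
    rwa [realize_restrictToFree θ] at hm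
    rintro ⟨i | i, hi⟩
    · rfl
    · simp [g, hi]
  · rintro ⟨m, hm⟩
    refine ⟨fun i => Sum.elim a m i.1, ?_⟩
    rwa [realize_restrictToFree θ]
    rintro ⟨i | i, hi⟩ <;> rfl

end Quantify

section Saturation

variable {L : FirstOrder.Language.{u, v}} {M : Type y} [L.Structure M] [Nonempty M]

/-- In an `ℵ₁`-saturated structure, one variable of a finitely satisfiable type in countably
many variables can be fixed. -/
theorem Aleph1Saturated.exists_fix (hM : Aleph1Saturated L M) (a : ℕ → M)
    {Γ : Set (L.Formula (ℕ ⊕ ℕ))} (k : ℕ) (m : ℕ → M)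
    (h : ∀ q ⊆ Γ, q.Finite → ∃ n : ℕ → M, (∀ i < k, n i = m i) ∧
      ∀ φ ∈ q, φ.Realize (Sum.elim a n)) :
    ∃ m' : ℕ → M, (∀ i < k, m' i = m i) ∧
      ∀ q ⊆ Γ, q.Finite → ∃ n : ℕ → M, (∀ i < k + 1, n i = m' i) ∧
        ∀ φ ∈ q, φ.Realize (Sum.elim a n) := by
  classical
  -- The parameters `a` sit at even positions and the values `m` at odd ones. The type to realize
  -- for variable `k` says, for each finite part of `Γ`, that the later variables can still be
  -- found.
  let b : ℕ → M := fun n => if n % 2 = 0 then a (n / 2) else m (n / 2)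
  have hb0 : ∀ n, b (2 * n) = a n := fun n => by simp [b]
  have hb1 : ∀ n, b (2 * n + 1) = m n := fun n => by
    simp [b, Nat.add_mod, show (2 * n + 1) / 2 = n by omega]
  let g : ℕ ⊕ ℕ → (ℕ ⊕ Fin 1) ⊕ ℕ := Sum.elim (fun n => .inl (.inl (2 * n))) fun i =>
    if i < k then .inl (.inl (2 * i + 1)) else if i = k then .inl (.inr 0) else .inr i
  have hex : ∀ θ : L.Formula (ℕ ⊕ ℕ), ∃ χ : L.Formula (ℕ ⊕ Fin 1), ∀ x : Fin 1 → M,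
      χ.Realize (Sum.elim b x) ↔ ∃ n : ℕ → M, (∀ i < k, n i = m i) ∧ n k = x 0 ∧
        θ.Realize (Sum.elim a n) := by
    intro θ
    obtain ⟨χ, hχ⟩ := exists_formula_exists (M := M) (θ.relabel g)
    refine ⟨χ, fun x => (hχ _).trans ?_⟩
    simp only [Formula.realize_relabel]
    constructor
    · rintro ⟨n, hn⟩
      refine ⟨fun i => if i < k then m i else if i = k then x 0 else n i, ?_, ?_, ?_⟩
      · intro i hi; simp [hi]
      · simp
      · convert hn using 1
        funext i
        rcases i with i | i
        · simp [g, hb0]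
        · by_cases h1 : i < k
          · simp [g, h1, hb1]
          · by_cases h2 : i = k
            · simp [g, h2]
            · simp [g, h1, h2]
    · rintro ⟨n, h1, h2, h3⟩
      refine ⟨n, ?_⟩
      convert h3 using 1
      funext i
      rcases i with i | i
      · simp [g, hb0]
      · by_cases h4 : i < k
        · simp [g, h4, hb1, h1]
        · by_cases h5 : i = k
          · simp [g, h5, h2]
          · simp [g, h4, h5]
  choose χ hχ using hex
  obtain ⟨x, hx⟩ := aleph1Saturated_iff.1 hM b
    {ψ | ∃ (q : Set (L.Formula (ℕ ⊕ ℕ))) (hf : q.Finite), q ⊆ Γ ∧ ψ = χ (conj q hf)} (by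
      intro r hr hf
      have := hf.to_subtype
      choose q hq1 hq2 hq3 using fun ψ : r => hr ψ.2
      obtain ⟨n, hn1, hn2⟩ := h (⋃ ψ, q ψ) (Set.iUnion_subset hq2) (Set.finite_iUnion hq1)
      refine ⟨fun _ => n k, fun ψ hψ => ?_⟩
      rw [show ψ = _ from hq3 ⟨ψ, hψ⟩, hχ]
      exact ⟨n, hn1, rfl, (realize_conj _).2 fun φ hφ => hn2 φ (Set.mem_iUnion.2 ⟨_, hφ⟩)⟩)
  refine ⟨fun i => if i = k then x 0 else m i, fun i hi => by simp [hi.ne], fun q hq hf => ?_⟩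
  obtain ⟨n, hn1, hn2, hn3⟩ := (hχ _ x).1 (hx _ ⟨q, hf, hq, rfl⟩)
  refine ⟨n, fun i hi => ?_, (realize_conj hf).1 hn3⟩
  by_cases h1 : i = k
  · simp [h1, hn2]
  · simp [h1, hn1 i (by omega)]

theorem Aleph1Saturated.exists_realize_nat (hM : Aleph1Saturated L M) (a : ℕ → M)
    {Γ : Set (L.Formula (ℕ ⊕ ℕ))} (h : FinSatOver a Γ) :
    ∃ m : ℕ → M, ∀ φ ∈ Γ, φ.Realize (Sum.elim a m) := by
  classical
  let P : ℕ → (ℕ → M) → Prop := fun k m => ∀ q ⊆ Γ, q.Finite →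
    ∃ n : ℕ → M, (∀ i < k, n i = m i) ∧ ∀ φ ∈ q, φ.Realize (Sum.elim a n)
  have step : ∀ (k : ℕ) (m : {m // P k m}), ∃ m' : {m // P (k + 1) m},
      ∀ i < k, m'.1 i = m.1 i := fun k m => by
    obtain ⟨m', h1, h2⟩ := hM.exists_fix a k m.1 m.2
    exact ⟨⟨m', h2⟩, h1⟩
  choose F hF using step
  let s : ∀ k, {m // P k m} := fun k => Nat.rec
    ⟨fun _ => Classical.arbitrary M, fun q hq hf =>
      (h q hq hf).imp fun n hn => ⟨fun _ hi => absurd hi (Nat.not_lt_zero _), hn⟩⟩ F k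
  have hs : ∀ i k, i < k → (s k).1 i = (s (i + 1)).1 i := by
    intro i k hk
    induction k, hk using Nat.le_induction with
    | base => rfl
    | succ k hk ih => exact (hF k (s k) i hk).trans ih
  refine ⟨fun i => (s (i + 1)).1 i, fun φ hφ => ?_⟩
  -- After stage `K`, all the values that `φ` mentions are fixed for good.
  let K := (φ.freeVarFinset.sup (Sum.elim id id)) + 1
  obtain ⟨n, hn1, hn2⟩ := (s K).2 {φ} (by simpa using hφ) (Set.finite_singleton _)
  rw [realize_congr_freeVars φ (b := Sum.elim a n)]
  · exact hn2 φ rfl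
  · rintro (i | i) hi
    · rfl
    · have : i < K := Nat.lt_succ_of_le
        (Finset.le_sup (f := Sum.elim id id) hi : Sum.elim id id (Sum.inr i : ℕ ⊕ ℕ) ≤ _)
      simp only [Sum.elim_inr]
      rw [hn1 i this, hs i K this]

/-- An `ℵ₁`-saturated structure realizes types in countably many variables, with countably many
parameters. -/
theorem Aleph1Saturated.exists_realize (hM : Aleph1Saturated L M) {ι : Type x} {V : Type z}
    [Countable ι] [Countable V] (a : ι → M) {Γ : Set (L.Formula (ι ⊕ V))}
    (h : FinSatOver a Γ) : ∃ m : V → M, ∀ φ ∈ Γ, φ.Realize (Sum.elim a m) := by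
  classical
  obtain ⟨f, hf⟩ := exists_injective_nat ι
  obtain ⟨g, hg⟩ := exists_injective_nat V
  obtain ⟨m, hm⟩ := hM.exists_realize_nat (Function.extend f a fun _ => Classical.arbitrary M)
    (Γ := (fun φ : L.Formula (ι ⊕ V) => φ.relabel (Sum.map f g)) '' Γ) (by
      intro q hq hfin
      obtain ⟨q', h1, h2, rfl⟩ := exists_finite_image_eq hfin hq
      obtain ⟨m, hm⟩ := h q' h1 h2
      refine ⟨Function.extend g m fun _ => Classical.arbitrary M, ?_⟩
      rintro _ ⟨φ, hφ, rfl⟩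
      rw [Formula.realize_relabel]
      convert hm φ hφ using 1
      funext i
      rcases i with i | i
      · simp [hf.extend_apply]
      · simp [hg.extend_apply])
  refine ⟨m ∘ g, fun φ hφ => ?_⟩
  have := hm _ ⟨φ, hφ, rfl⟩
  rw [Formula.realize_relabel] at this
  convert this using 1
  funext i
  rcases i with i | i
  · simp [hf.extend_apply]
  · rfl

theorem Aleph1Saturated.exists_realize_of_finSat (hM : Aleph1Saturated L M) {V : Type z}
    [Countable V] {Γ : Set (L.Formula V)} (h : FinSat M Γ) :
    ∃ m : V → M, ∀ φ ∈ Γ, φ.Realize m := by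
  obtain ⟨m, hm⟩ := hM.exists_realize (Empty.elim : Empty → M)
    (Γ := (fun φ : L.Formula V => φ.relabel Sum.inr) '' Γ) (by
      intro q hq hfin
      obtain ⟨q', h1, h2, rfl⟩ := exists_finite_image_eq hfin hq
      obtain ⟨m, hm⟩ := h q' h1 h2
      refine ⟨m, ?_⟩
      rintro _ ⟨φ, hφ, rfl⟩
      rw [Formula.realize_relabel]
      exact hm φ hφ)
  refine ⟨m, fun φ hφ => ?_⟩
  have := hm _ ⟨φ, hφ, rfl⟩
  rwa [Formula.realize_relabel] at this

end Saturation

/-! ### Indiscernible sequences and strict chains -/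

section Indiscernible

variable {L : FirstOrder.Language.{u, v}} {M : Type y} [L.Structure M]

theorem Indiscernible.realize_comp {ι : Type} [LinearOrder ι] {β : Type} {b : ι → β → M}
    (h : Indiscernible L b) {g : ι → ι} (hg : StrictMono g) (φ : L.Formula (ι × β)) :
    φ.Realize (fun p => b p.1 p.2) ↔ φ.Realize (fun p => b (g p.1) p.2) := by
  classical
  let F : Finset ι := φ.freeVarFinset.image Prod.fst
  let i := F.orderEmbOfFin rfl
  have hi : ∀ p : φ.freeVarFinset, ∃ j, i j = p.1.1 := fun p => by
    have h1 : p.1.1 ∈ Set.range i := by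
      rw [Finset.range_orderEmbOfFin]
      exact Finset.mem_image_of_mem _ p.2
    exact h1
  choose j hj using hi
  have key := h _ i (g ∘ i) i.strictMono (hg.comp i.strictMono)
    ((restrictToFree φ).relabel fun p => (j p, p.1.2))
  simp only [Formula.realize_relabel, Function.comp_def, hj] at key
  rwa [realize_restrictToFree φ (a := fun p => b p.1 p.2) (fun _ => rfl),
    realize_restrictToFree φ (a := fun p => b (g p.1) p.2) (fun _ => rfl)] at key

end Indiscernible

section StrictInclusion

variable {L : FirstOrder.Language.{u, v}} {M : Type y} [L.Structure M]

/-- The formula saying that one instance of `θ` is strictly contained in another one. -/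
noncomputable def ssubsetFormula {α β : Type} [Finite α] (θ : L.Formula (α ⊕ β)) :
    L.Formula (β ⊕ β) :=
  let θ₁ : L.Formula ((β ⊕ β) ⊕ α) := θ.relabel (Sum.elim .inr fun i => .inl (.inl i))
  let θ₂ : L.Formula ((β ⊕ β) ⊕ α) := θ.relabel (Sum.elim .inr fun i => .inl (.inr i))
  (θ₁.imp θ₂).iAlls α ⊓ (θ₂ ⊓ θ₁.not).iExs α

theorem realize_ssubsetFormula {α β : Type} [Finite α] (θ : L.Formula (α ⊕ β))
    (b c : β → M) : (ssubsetFormula θ).Realize (Sum.elim b c) ↔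
      formulaInstance θ b ⊂ formulaInstance θ c := by
  have h1 : ∀ a : α → M, Sum.elim (Sum.elim b c) a ∘ Sum.elim .inr (fun i => .inl (.inl i)) =
      Sum.elim a b := fun a => by funext i; cases i <;> rfl
  have h2 : ∀ a : α → M, Sum.elim (Sum.elim b c) a ∘ Sum.elim .inr (fun i => .inl (.inr i)) =
      Sum.elim a c := fun a => by funext i; cases i <;> rfl
  simp only [ssubsetFormula, Formula.realize_inf, Formula.realize_iAlls, Formula.realize_iExs,
    Formula.realize_imp, Formula.realize_not, Formula.realize_relabel, h1, h2]
  rw [Set.ssubset_iff_exists]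
  rfl

/-- A formula defining arbitrarily long finite strict chains witnesses the strict order
property. -/
theorem not_nsop_of_finite_chains {T : L.Theory} {α β : Type} [Finite α] [Finite β]
    (θ : L.Formula (α ⊕ β)) (N : Theory.ModelType.{u, v, x} T)
    (h : ∀ K : ℕ, ∃ c : ℕ → β → N, ∀ i < K,
      formulaInstance θ (c i) ⊂ formulaInstance θ (c (i + 1))) : ¬ NSOP T := by
  intro hT
  obtain ⟨r, ⟨e⟩⟩ := Finite.exists_equiv_fin α
  obtain ⟨s, ⟨f⟩⟩ := Finite.exists_equiv_fin β
  let φ : L.Formula (Fin r ⊕ Fin s) := θ.relabel (Sum.map e f)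
  let g : ℕ → L.Formula (ℕ × Fin s) := fun i =>
    (ssubsetFormula φ).relabel (Sum.elim (fun j => (i, j)) fun j => (i + 1, j))
  have hg : ∀ {P : Type (max u v)} [L.Structure P] (i : ℕ) (b : ℕ × Fin s → P),
      (g i).Realize b ↔ formulaInstance φ (fun j => b (i, j)) ⊂
        formulaInstance φ (fun j => b (i + 1, j)) := by
    intro P _ i b
    rw [← realize_ssubsetFormula, Formula.realize_relabel]
    apply iff_of_eq
    congr 1
    funext j; cases j <;> rfl
  obtain ⟨P, b, hb⟩ := exists_model_realize (T := T) (Set.range g) (by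
    intro q hq hf
    rw [← Set.image_univ] at hq
    obtain ⟨s', -, h2, rfl⟩ := exists_finite_image_eq hf hq
    obtain ⟨K, hK⟩ := h2.bddAbove
    obtain ⟨c, hc⟩ := h (K + 1)
    refine ⟨N, fun p => c p.1 (f.symm p.2), ?_⟩
    rintro _ ⟨i, hi, rfl⟩
    have h3 := hc i (Nat.lt_succ_of_le (hK hi))
    have h4 : ∀ i, formulaInstance φ (fun j => c i (f.symm j)) =
        (fun a : Fin r → N => a ∘ e) ⁻¹' formulaInstance θ (c i) := by
      intro i
      ext a
      simp only [formulaInstance, φ, Set.mem_ofPred_eq, Formula.realize_relabel, Set.mem_preimage]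
      apply iff_of_eq
      congr 1
      funext j; cases j <;> simp
    have h5 : Function.Surjective fun a : Fin r → N => a ∘ e :=
      fun a => ⟨a ∘ e.symm, by funext j; simp⟩
    rw [Formula.realize_relabel]
    have h6 := (realize_ssubsetFormula φ (fun j => c i (f.symm j))
      (fun j => c (i + 1) (f.symm j))).2 (by
        rw [h4, h4]
        exact ⟨Set.preimage_mono h3.1,
          fun h6 => h3.2 (h5.preimage_subset_preimage_iff.1 h6)⟩)
    convert h6 using 1
    funext j; cases j <;> rfl)
  exact hT r s φ ⟨P, fun i j => b (i, j), fun i => (hg i b).1 (hb _ ⟨i, rfl⟩)⟩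

end StrictInclusion

/-! ### Switching adjacent entries of a finite pattern -/

section Patterns

variable {L : FirstOrder.Language.{u, v}} {M : Type y} [L.Structure M] {α β : Type}

/-- Some tuple satisfies the instances `φ(x, y_m)`, for `m ∈ F`, exactly when `J m`. -/
def RealizesPattern (φ : L.Formula (α ⊕ β)) (F : Finset ℤ) (J : ℤ → Prop) (b : ℤ → β → M) : Prop :=
  ∃ a : α → M, ∀ m ∈ F, φ.Realize (Sum.elim a (b m)) ↔ J m

open Classical in
/-- The formula `φ`, or its negation if `P` is false. -/
noncomputable def literal (φ : L.Formula (α ⊕ β)) (P : Prop) : L.Formula (α ⊕ β) :=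
  if P then φ else φ.not

theorem realize_literal (φ : L.Formula (α ⊕ β)) (P : Prop) (c : α ⊕ β → M) :
    (literal φ P).Realize c ↔ (φ.Realize c ↔ P) := by
  by_cases h : P <;> simp [literal, h]

variable [Finite α]

theorem Indiscernible.realizesPattern_comp {φ : L.Formula (α ⊕ β)} {F : Finset ℤ}
    {J : ℤ → Prop} {b : ℤ → β → M} (hb : Indiscernible L b) {g : ℤ → ℤ} (hg : StrictMono g) :
    RealizesPattern φ F J b ↔ RealizesPattern φ F J fun m => b (g m) := by
  let lit : F → L.Formula ((ℤ × β) ⊕ α) := fun m =>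
    (literal φ (J m)).relabel (Sum.elim .inr fun j => .inl (m.1, j))
  have key : ∀ c : ℤ → β → M, ((Formula.iInf lit).iExs α).Realize (fun p => c p.1 p.2) ↔
      RealizesPattern φ F J c := by
    intro c
    simp only [Formula.realize_iExs, Formula.realize_iInf, lit, Formula.realize_relabel,
      realize_literal, RealizesPattern, Subtype.forall]
    refine exists_congr fun a => forall₂_congr fun m _ => iff_congr (iff_of_eq ?_) Iff.rfl
    congr 1
    funext j; cases j <;> rfl
  rw [← key, ← key]
  exact hb.realize_comp hg _

/-- If the switched pattern is not realized, then under the other conditions `φ(x, b_q)` implies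
`φ(x, b_q')` whenever `q' < q` take the places of `p` and `p + 1`. The original pattern shows that
the converse implication fails, so a strict chain arises. -/
theorem RealizesPattern.swap_of_and_not [Finite β] {T : L.Theory} (hT : NSOP T)
    {N : Theory.ModelType.{u, v, x} T} {φ : L.Formula (α ⊕ β)} {F : Finset ℤ} {J : ℤ → Prop}
    {b : ℤ → β → N} (hb : Indiscernible L b) {p : ℤ} (hp : p ∈ F) (hp' : p + 1 ∈ F) (hJ : J p)
    (hJ' : ¬ J (p + 1)) (h : RealizesPattern φ F J b) :
    RealizesPattern φ F (fun m => J (Equiv.swap p (p + 1) m)) b := by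
  by_contra hno
  let θ : L.Formula (α ⊕ (F × β)) := Formula.iInf fun m : {m : F // m.1 ≠ p + 1} =>
    (literal φ (J m.1)).relabel (Sum.map id fun j => (m.1, j))
  have hθ : ∀ (c : ℤ → β → N) (a : α → N), a ∈ formulaInstance θ (fun q => c q.1 q.2) ↔
      ∀ m ∈ F, m ≠ p + 1 → (φ.Realize (Sum.elim a (c m)) ↔ J m) := by
    intro c a
    simp only [formulaInstance, θ, Set.mem_ofPred_eq, Formula.realize_iInf, realize_literal,
      Formula.realize_relabel, Subtype.forall]
    refine forall₃_congr fun m _ _ => iff_congr (iff_of_eq ?_) Iff.rfl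
    congr 1
    funext j; cases j <;> rfl
  refine not_nsop_of_finite_chains θ N (fun K => ?_) hT
  -- Indices beyond `p + 1` move right by `K`, leaving room for `p` at all of `p, ..., p + K`. The
  -- value at `p + 1` is irrelevant, since `θ` has no condition there.
  let k : ℕ → ℤ → ℤ := fun i m => if m < p then m else if m = p then p + i else m + K
  -- The order is reversed because the instances shrink as `p` moves right.
  refine ⟨fun i q => b (k (K - i) q.1) q.2, fun i hi => ?_⟩
  obtain ⟨j, hj⟩ : ∃ j, K - i = j + 1 := ⟨K - i - 1, by omega⟩
  have hjK : j + 1 ≤ K := by omega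
  beta_reduce
  rw [show K - (i + 1) = j by omega, hj]
  -- Along `g`, the places of `p` and `p + 1` are the two consecutive positions of the moving index,
  -- so both the realized and the omitted pattern can be read there.
  let g : ℤ → ℤ := fun m => if m = p + 1 then p + (j + 1) else k j m
  have hg : StrictMono g := by
    intro m n hmn
    simp only [g, k]
    split_ifs <;> omega
  have hgk : ∀ m, m ≠ p + 1 → g m = k j m := fun m hm => by simp [g, hm]
  have hkk : ∀ m, m ≠ p → k (j + 1) m = k j m := fun m hm => by simp [k, hm]
  have hgp : g (p + 1) = k (j + 1) p := by simp [g, k]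
  rw [hb.realizesPattern_comp hg] at h hno
  refine ⟨fun a ha => ?_, fun hsub => ?_⟩
  · rw [hθ fun m => b (k (j + 1) m)] at ha
    refine (hθ (fun m => b (k j m)) a).2 fun m hm hm' => ?_
    by_cases hmp : m = p
    · subst hmp
      refine iff_of_true ?_ hJ
      by_contra hφ
      refine hno ⟨a, fun n hn => ?_⟩
      beta_reduce
      by_cases h1 : n = m
      · subst h1
        rw [hgk n (by omega), Equiv.swap_apply_left]
        exact iff_of_false hφ hJ'
      by_cases h2 : n = m + 1
      · subst h2
        rw [hgp, Equiv.swap_apply_right]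
        exact ha m hm (by omega)
      · rw [hgk n h2, Equiv.swap_apply_of_ne_of_ne h1 h2, ← hkk n h1]
        exact ha n hn h2
    · rw [← hkk m hmp]
      exact ha m hm hm'
  · obtain ⟨a, ha⟩ := h
    have h1 : a ∈ formulaInstance θ fun q => b (k j q.1) q.2 :=
      (hθ (fun m => b (k j m)) a).2 fun m hm hm' => by
        rw [← hgk m hm']; exact ha m hm
    have h2 := ((hθ (fun m => b (k (j + 1) m)) a).1 (hsub h1) p hp (by omega)).2 hJ
    rw [← hgp] at h2
    exact hJ' ((ha _ hp').1 h2)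

/-- Equal entries make the switch trivial; the case of false followed by true reduces to the
previous lemma by negating `φ`. -/
theorem RealizesPattern.swap [Finite β] {T : L.Theory} (hT : NSOP T)
    {N : Theory.ModelType.{u, v, x} T} {φ : L.Formula (α ⊕ β)} {F : Finset ℤ} {J : ℤ → Prop}
    {b : ℤ → β → N} (hb : Indiscernible L b) {p : ℤ} (hp : p ∈ F) (hp' : p + 1 ∈ F)
    (h : RealizesPattern φ F J b) :
    RealizesPattern φ F (fun m => J (Equiv.swap p (p + 1) m)) b := by
  by_cases h1 : J p <;> by_cases h2 : J (p + 1)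
  · convert h using 2 with m
    by_cases h3 : m = p
    · subst h3; simp [h1, h2]
    by_cases h4 : m = p + 1
    · subst h4; simp [h1, h2]
    · rw [Equiv.swap_apply_of_ne_of_ne h3 h4]
  · exact h.swap_of_and_not hT hb hp hp' h1 h2
  · have hneg : ∀ J : ℤ → Prop,
        RealizesPattern φ.not F (fun m => ¬ J m) b ↔ RealizesPattern φ F J b := fun J =>
      exists_congr fun a => forall₂_congr fun m _ => by rw [Formula.realize_not, not_iff_not]
    exact (hneg _).1 (((hneg J).2 h).swap_of_and_not hT hb hp hp' h1 (not_not.2 h2))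
  · convert h using 2 with m
    by_cases h3 : m = p
    · subst h3; simp [h1, h2]
    by_cases h4 : m = p + 1
    · subst h4; simp [h1, h2]
    · rw [Equiv.swap_apply_of_ne_of_ne h3 h4]

end Patterns

/-! ### Symbolic images in models of NSOP theories -/

section Automorphisms

variable {L : FirstOrder.Language.{u, v}} {M : Type y} [L.Structure M]

theorem realize_zpow_comp (σ : M ≃[L] M) (n : ℤ) {V : Type x} (φ : L.Formula V) (a : V → M) :
    φ.Realize (fun i => ((σ.toEquiv : Equiv.Perm M) ^ n) (a i)) ↔ φ.Realize a := by
  have hσ : ∀ c : V → M, φ.Realize (fun i => σ.toEquiv (c i)) ↔ φ.Realize c := fun c =>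
    StrongHomClass.realize_formula σ φ
  induction n generalizing a with
  | zero => rfl
  | succ n ih =>
    simpa only [zpow_add_one, Equiv.Perm.mul_apply, hσ] using ih (fun i => σ.toEquiv (a i))
  | pred n ih =>
    rw [show (-(n : ℤ) - 1) = -n + -1 by ring]
    simp only [zpow_add, Equiv.Perm.mul_apply, zpow_neg_one]
    refine (ih _).trans ?_
    rw [← hσ]
    exact iff_of_eq (congrArg φ.Realize (funext fun i => σ.toEquiv.apply_symm_apply (a i)))

theorem autPow_autPow (σ : M ≃[L] M) (m n : ℤ) {α : Type} (a : α → M) :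
    autPow σ m (autPow σ n a) = autPow σ (m + n) a := by
  funext i
  simp [autPow, zpow_add]

theorem mem_symbolicRep_iff (σ : M ≃[L] M) {α β : Type} (φ : L.Formula (α ⊕ β)) (a : α → M)
    (b : β → M) (n : ℤ) : n ∈ symbolicRep σ (formulaInstance φ b) a ↔
      φ.Realize (Sum.elim a (autPow σ (-n) b)) := by
  rw [← realize_zpow_comp σ n]
  change φ.Realize (Sum.elim (autPow σ n a) b) ↔ _
  apply iff_of_eq
  congr 1
  funext i
  rcases i with i | i
  · rfl
  · exact (congrFun ((autPow_autPow σ n (-n) b).trans (by simp; rfl)) i).symm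

theorem shift_mem_symbolicImage (σ : M ≃[L] M) {α : Type} {U : Set (α → M)} (k : ℤ) {I : Set ℤ}
    (hI : I ∈ symbolicImage σ U) : shift k I ∈ symbolicImage σ U := by
  obtain ⟨a, rfl⟩ := hI
  refine ⟨autPow σ (-k) a, ?_⟩
  ext n
  simp only [symbolicRep, shift, Set.mem_ofPred_eq, autPow_autPow, sub_eq_add_neg]

/-- In an `ℵ₁`-saturated model of an NSOP theory, symbolic images are SW-closed. -/
theorem NSOP.symbolicImagesSWClosed {T : L.Theory} (hT : NSOP T)
    (N : Theory.ModelType.{u, v, x} T) (hN : Aleph1Saturated L N) :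
    SymbolicImagesSWClosed L N := by
  classical
  intro r s φ b σ hσ
  refine ⟨fun k I => shift_mem_symbolicImage σ k, ?_⟩
  rintro _ ⟨a, rfl⟩
  let c : ℤ → Fin s → N := fun n => autPow σ n b
  have hc : Indiscernible L c := hσ
  let J : ℤ → Prop := fun m => φ.Realize (Sum.elim a (c m))
  -- Coordinate `n` corresponds to index `-n`, so switching the coordinates 0 and 1 exchanges the
  -- indices 0 and -1.
  let J' : ℤ → Prop := fun m => J (Equiv.swap (-1) (-1 + 1) m)
  let lit : ℤ → L.Formula ((ℤ × Fin s) ⊕ Fin r) := fun m =>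
    (literal φ (J' m)).relabel (Sum.elim .inr fun j => .inl (m, j))
  have hlit : ∀ m (d : Fin r → N), (lit m).Realize (Sum.elim (fun p => c p.1 p.2) d) ↔
      (φ.Realize (Sum.elim d (c m)) ↔ J' m) := by
    intro m d
    rw [Formula.realize_relabel, realize_literal]
    refine iff_congr (iff_of_eq ?_) Iff.rfl
    congr 1
    funext j; cases j <;> rfl
  obtain ⟨d, hd⟩ := hN.exists_realize (fun p : ℤ × Fin s => c p.1 p.2) (Γ := Set.range lit) (by
    intro q hq hf
    rw [← Set.image_univ] at hq
    obtain ⟨F, -, hF, rfl⟩ := exists_finite_image_eq hf hq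
    have h1 : RealizesPattern φ (insert (-1) (insert (-1 + 1) hF.toFinset)) J c :=
      ⟨a, fun _ _ => Iff.rfl⟩
    obtain ⟨d, hd⟩ := h1.swap hT hc (p := -1) (by simp) (by simp)
    refine ⟨d, ?_⟩
    rintro _ ⟨m, hm, rfl⟩
    exact (hlit m d).2 (hd m (by simp [hm])))
  refine ⟨d, ?_⟩
  ext n
  have h1 := (hlit (-n) d).1 (hd _ ⟨-n, rfl⟩)
  rw [mem_symbolicRep_iff, switch, Set.mem_ofPred_eq, mem_symbolicRep_iff]
  refine h1.trans ?_
  have h2 : Equiv.swap (-1 : ℤ) (-1 + 1) (-n) = -Equiv.swap 0 1 n := by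
    simp only [Equiv.swap_apply_def]
    split_ifs <;> omega
  simp only [J', J, h2]
  rfl

end Automorphisms

open Filter

/-! ### Iterated ultrafilters on increasing tuples -/

section Ultrafilters

/-- The iterated product of a nonprincipal ultrafilter on `ℕ`. -/
noncomputable def iteratedHyperfilter : ∀ k : ℕ, Ultrafilter (Fin k → ℕ)
  | 0 => pure Fin.elim0
  | k + 1 => (hyperfilter ℕ).bind fun n => (iteratedHyperfilter k).map (Fin.cons n)

theorem eventually_iteratedHyperfilter_succ {k : ℕ} {P : (Fin (k + 1) → ℕ) → Prop} :
    (∀ᶠ x in iteratedHyperfilter (k + 1), P x) ↔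
      ∀ᶠ n in hyperfilter ℕ, ∀ᶠ x in iteratedHyperfilter k, P (Fin.cons n x) :=
  Iff.rfl

theorem cons_apply_of_ne_zero {m : ℕ} (n : ℕ) (x : Fin m → ℕ) (i : Fin (m + 1)) (h : i ≠ 0) :
    (Fin.cons n x : Fin (m + 1) → ℕ) i = x (i.pred h) := by
  obtain ⟨j, rfl⟩ := Fin.exists_succ_eq.2 h
  simp

/-- The marginal of the iterated product on any increasing choice of coordinates is again an
iterated product: a coordinate outside the range of `e` is a dummy. Hence conditions on different
subtuples can be met together. -/
theorem eventually_iteratedHyperfilter_comp {m : ℕ} : ∀ {k : ℕ} {e : Fin k → Fin m},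
    StrictMono e → ∀ {P : (Fin k → ℕ) → Prop}, (∀ᶠ x in iteratedHyperfilter k, P x) →
      ∀ᶠ x in iteratedHyperfilter m, P (x ∘ e) := by
  induction m with
  | zero =>
    intro k e he P h
    obtain rfl : k = 0 := by
      by_contra hk
      exact (e ⟨0, Nat.pos_of_ne_zero hk⟩).elim0
    convert h
  | succ m ih =>
    intro k e he P h
    rw [eventually_iteratedHyperfilter_succ]
    by_cases h0 : ∀ i, e i ≠ 0
    · have he' : StrictMono fun i => (e i).pred (h0 i) := fun i j hij => by
        simpa using he hij
      refine Eventually.of_forall fun n => (ih he' h).mono fun x hx => ?_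
      convert hx using 1
      funext i
      exact cons_apply_of_ne_zero n x _ _
    · push Not at h0
      obtain ⟨i, hi⟩ := h0
      obtain _ | k := k
      · exact i.elim0
      have he0 : e 0 = 0 := Fin.le_zero_iff.1 (hi ▸ he.monotone (Fin.zero_le i))
      have hs : ∀ j : Fin k, e j.succ ≠ 0 := fun j h1 =>
        (he (Fin.succ_pos j)).ne (he0.trans h1.symm)
      have he' : StrictMono fun j : Fin k => (e j.succ).pred (hs j) := fun j l hjl => by
        simpa using he (Fin.succ_lt_succ_iff.2 hjl)
      rw [eventually_iteratedHyperfilter_succ] at h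
      refine h.mono fun n hn => (ih he' hn).mono fun x hx => ?_
      convert hx using 1
      funext j
      refine Fin.cases ?_ (fun j => ?_) j
      · simp [he0]
      · exact cons_apply_of_ne_zero n x _ _

theorem eventually_iteratedHyperfilter_two {P : ℕ → ℕ → Prop} (h : ∀ m n, m < n → P m n) :
    ∀ᶠ x : Fin 2 → ℕ in iteratedHyperfilter 2, P (x 0) (x 1) := by
  rw [eventually_iteratedHyperfilter_succ]
  refine Eventually.of_forall fun m => ?_
  rw [eventually_iteratedHyperfilter_succ]
  refine ((eventually_gt_atTop m).filter_mono Nat.hyperfilter_le_atTop).mono fun n hn => ?_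
  exact Eventually.of_forall fun _ => h m n hn

end Ultrafilters

/-! ### Extracting indiscernibles, and the converse direction -/

section AverageType

variable {L : FirstOrder.Language.{u, v}} {M : Type y} [L.Structure M] {β : Type}

variable (L) in
/-- The type of an indiscernible sequence indexed by `ℤ` extracted from the sequence `b`. -/
def averageType (b : ℕ → β → M) : Set (L.Formula (ℤ × β)) :=
  {φ | ∃ (k : ℕ) (i : Fin k → ℤ) (ψ : L.Formula (Fin k × β)), StrictMono i ∧
    (∀ᶠ n : Fin k → ℕ in iteratedHyperfilter k, ψ.Realize fun p => b (n p.1) p.2) ∧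
      φ = ψ.relabel fun p => (i p.1, p.2)}

/-- Finitely many formulas involve finitely many indices, listed increasingly by `g`. Each formula
holds for almost all tuples put at these indices, so one tuple serves them all. -/
theorem finSat_averageType (b : ℕ → β → M) : FinSat M (averageType L b) := by
  classical
  intro q hq hf
  have := hf.fintype
  choose k i ψ hi hψ heq using fun φ : q => hq φ.2
  let F : Finset ℤ := Finset.univ.biUnion fun φ : q => Finset.univ.image (i φ)
  let g := F.orderEmbOfFin rfl
  have hg : ∀ φ j, ∃ l, g l = i φ j := fun φ j => by
    have h1 : i φ j ∈ Set.range g := by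
      rw [Finset.range_orderEmbOfFin]
      exact Finset.mem_biUnion.2 ⟨φ, Finset.mem_univ _,
        Finset.mem_image_of_mem _ (Finset.mem_univ _)⟩
    exact h1
  choose e he using hg
  have hmono : ∀ φ, StrictMono (e φ) := fun φ j l hjl => by
    rw [← g.lt_iff_lt, he, he]
    exact hi φ hjl
  obtain ⟨n, hn⟩ := (eventually_all.2 fun φ =>
    eventually_iteratedHyperfilter_comp (hmono φ) (hψ φ)).exists
  refine ⟨fun p => b (Function.extend g n (fun _ => 0) p.1) p.2, fun φ hφ => ?_⟩
  rw [show φ = _ from heq ⟨φ, hφ⟩, Formula.realize_relabel]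
  have h1 := hn ⟨φ, hφ⟩
  convert h1 using 1
  funext p
  simp only [Function.comp_apply]
  rw [← he, g.injective.extend_apply]

/-- The ultrafilter decides each formula by its tuple length alone, regardless of the increasing
indices chosen. -/
theorem indiscernible_of_realize_averageType {N : Type z} [L.Structure N] {b : ℕ → β → M}
    {c : ℤ × β → N} (hc : ∀ φ ∈ averageType L b, φ.Realize c) :
    Indiscernible L fun z t => c (z, t) := by
  intro k i j hi hj φ
  have key : ∀ {i : Fin k → ℤ}, StrictMono i → ((φ.Realize fun p => c (i p.1, p.2)) ↔
      ∀ᶠ n : Fin k → ℕ in iteratedHyperfilter k, φ.Realize fun p => b (n p.1) p.2) := by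
    intro i hi
    constructor
    · intro h
      by_contra h1
      have h2 := hc _ ⟨k, i, φ.not, hi, Ultrafilter.eventually_not.2 h1, rfl⟩
      rw [Formula.realize_relabel] at h2
      exact h2 h
    · intro h
      have h2 := hc _ ⟨k, i, φ, hi, h, rfl⟩
      rwa [Formula.realize_relabel] at h2
  exact (key hi).trans (key hj).symm

theorem strictMono_of_realize_averageType {N : Type z} [L.Structure N] {b : ℕ → β → M}
    {c : ℤ × β → N} (hc : ∀ φ ∈ averageType L b, φ.Realize c) {α : Type} [Finite α]
    {θ : L.Formula (α ⊕ β)} (hθ : StrictMono fun n => formulaInstance θ (b n)) :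
    StrictMono fun z => formulaInstance θ fun t => c (z, t) := by
  refine strictMono_int_of_lt_succ fun z => ?_
  let ψ : L.Formula (Fin 2 × β) :=
    (ssubsetFormula θ).relabel (Sum.elim (fun t => (0, t)) fun t => (1, t))
  have h1 := hc _ ⟨2, ![z, z + 1], ψ, by
    refine Fin.strictMono_iff_lt_succ.2 fun i => ?_
    rw [Subsingleton.elim i 0]
    simp, (eventually_iteratedHyperfilter_two
      (P := fun m n => formulaInstance θ (b m) ⊂ formulaInstance θ (b n))
      fun m n h => hθ h).mono fun n hn => by
        rw [Formula.realize_relabel]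
        convert (realize_ssubsetFormula θ _ _).2 hn using 1
        funext j; cases j <;> rfl, rfl⟩
  rw [Formula.realize_relabel, Formula.realize_relabel] at h1
  refine (realize_ssubsetFormula θ _ _).1 ?_
  convert h1 using 1
  funext j; cases j <;> rfl

/-- In a saturated and homogeneous structure, the strict order property is visible in the
symbolic images. -/
theorem not_symbolicImagesSWClosed {N : Type z} [L.Structure N] [Nonempty M] [Nonempty N]
    (hMN : M ≅[L] N) {r s : ℕ} {φ : L.Formula (Fin r ⊕ Fin s)} {b : ℕ → Fin s → M}
    (hb : ∀ i, formulaInstance φ (b i) ⊂ formulaInstance φ (b (i + 1)))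
    (hsat : Aleph1Saturated L N) (hhom : StronglyAleph1Homogeneous L N) :
    ¬ SymbolicImagesSWClosed L N := by
  intro hclosed
  obtain ⟨c, hc⟩ := hsat.exists_realize_of_finSat
    ((finSat_averageType (L := L) b).of_elementarilyEquivalent hMN)
  have hind := indiscernible_of_realize_averageType hc
  have hmono := strictMono_of_realize_averageType hc (strictMono_nat_of_lt_succ hb)
  -- Without parameters all instances coincide, so no inclusion is strict. Nonemptiness is needed to
  -- enumerate `ℤ × Fin s` by `ℕ`.
  have : Nonempty (Fin s) := by
    by_contra hs
    rw [not_nonempty_iff] at hs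
    exact (hb 0).ne (by rw [Subsingleton.elim (b 0) (b (0 + 1))])
  obtain ⟨f, hf⟩ := exists_surjective_nat (ℤ × Fin s)
  obtain ⟨σ, hσ⟩ := hhom (fun n => c (f n)) (fun n => c ((f n).1 + 1, (f n).2)) (by
    intro ψ
    have := hind.realize_comp (g := fun z => z + 1) (fun _ _ h => by simpa using h)
      (ψ.relabel f)
    simpa only [Formula.realize_relabel, Function.comp_def] using this)
  have hσ' : ∀ z t, σ.toEquiv (c (z, t)) = c (z + 1, t) := by
    intro z t
    obtain ⟨n, hn⟩ := hf (z, t)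
    have := hσ n
    rw [hn] at this
    exact this
  let B : Fin s → N := fun t => c (0, t)
  have hB : ∀ n : ℤ, autPow σ n B = fun t => c (n, t) := by
    intro n
    induction n with
    | zero => rfl
    | succ n ih =>
      rw [add_comm, ← autPow_autPow, ih]
      funext t
      rw [add_comm, ← hσ']
      rfl
    | pred n ih =>
      rw [sub_eq_add_neg, add_comm, ← autPow_autPow, ih]
      funext t
      have := hσ' (-1 + -n) t
      rw [show (-1 + -(n : ℤ) + 1) = -n by ring] at this
      change σ.toEquiv.symm _ = _
      exact σ.toEquiv.symm_apply_eq.2 this.symm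
  have hW : σ ∈ indiscernibleAuts (L := L) B := by
    change Indiscernible L fun n : ℤ => autPow σ n B
    simp only [hB]
    exact hind
  have hrep : ∀ a n, n ∈ symbolicRep σ (formulaInstance φ B) a ↔
      a ∈ formulaInstance φ fun t => c (-n, t) := by
    intro a n
    rw [mem_symbolicRep_iff, hB]
    rfl
  -- Its representation contains 0 but not 1; the switched one would contradict the inclusion of the
  -- instance at -1 in the instance at 0.
  obtain ⟨a, ha1, ha2⟩ := Set.exists_of_ssubset (hmono (show (-1 : ℤ) < 0 by norm_num))
  obtain ⟨a', ha'⟩ := (hclosed r s φ B σ hW).2 _ ⟨a, rfl⟩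
  have h0 : (0 : ℤ) ∉ symbolicRep σ (formulaInstance φ B) a' := by
    rw [ha', switch, Set.mem_ofPred_eq, Equiv.swap_apply_left, hrep]
    exact ha2
  have h1 : (1 : ℤ) ∈ symbolicRep σ (formulaInstance φ B) a' := by
    rw [ha', switch, Set.mem_ofPred_eq, Equiv.swap_apply_right, hrep]
    exact ha1
  rw [hrep] at h0 h1
  exact h0 (hmono.monotone (show (-1 : ℤ) ≤ -0 by norm_num) h1)

end AverageType

end SymbolicNSOP
theorem mainTheorem6 {L : FirstOrder.Language.{u, v}} (T : L.Theory) :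
    (SymbolicNSOP.NSOP T ↔
      ∀ M : FirstOrder.Language.Theory.ModelType.{u, v, max u v w} T,
        SymbolicNSOP.Aleph1Saturated L M → SymbolicNSOP.SymbolicImagesSWClosed L M) ∧
    (T.IsComplete →
      (SymbolicNSOP.NSOP T ↔
        ∃ M : FirstOrder.Language.Theory.ModelType.{u, v, max u v w} T,
          SymbolicNSOP.Aleph1Saturated L M ∧ SymbolicNSOP.StronglyAleph1Homogeneous L M ∧
            SymbolicNSOP.SymbolicImagesSWClosed L M)) := by
  refine ⟨⟨fun hT M hM => hT.symbolicImagesSWClosed M hM, fun h r s φ ⟨M, b, hb⟩ => ?_⟩,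
    fun hT => ⟨fun hN => ?_, fun ⟨N, hsat, hhom, hN⟩ r s φ ⟨M, b, hb⟩ => ?_⟩⟩
  -- As `T` need not be complete, the model is built for the complete theory of `M`, so that it is
  -- elementarily equivalent to `M`.
  · obtain ⟨N, hsat, hhom⟩ := SymbolicNSOP.exists_saturated_homogeneous.{u, v, w}
      (FirstOrder.Language.Theory.Model.isSatisfiable (T := L.completeTheory M) M)
    have hMN : M ≅[L] N := FirstOrder.Language.elementarilyEquivalent_iff.2 fun ψ =>
      (FirstOrder.Language.realize_iff_of_model_completeTheory M N ψ).symm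
    have : N ⊨ T := hMN.theory_model
    exact SymbolicNSOP.not_symbolicImagesSWClosed hMN hb hsat hhom
      (h (FirstOrder.Language.Theory.ModelType.of T N) hsat)
  · obtain ⟨N, hsat, hhom⟩ := SymbolicNSOP.exists_saturated_homogeneous.{u, v, w} hT.1
    exact ⟨N, hsat, hhom, hN.symbolicImagesSWClosed N hsat⟩
  · have hMN : M ≅[L] N := FirstOrder.Language.elementarilyEquivalent_iff.2 fun ψ =>
      (hT.realize_sentence_iff ψ M).trans (hT.realize_sentence_iff ψ N).symm
    exact SymbolicNSOP.not_symbolicImagesSWClosed hMN hb hsat hhom hN
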